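/- Conventions. A C*-category is a category whose morphism spaces are complex Banach spaces, with bilinear composition satisfying $\|g\circ f\|\le\|g\|\|f\|$, and with isometric conjugate-linear involutions $*:\mathrm{Hom}(X,Y)\to\mathrm{Hom}(Y,X)$ such that $(f\circ g)^*=g^*\circ f^*$ and $\|f^*f\|=\|f\|^2$. It is a W*-category if every $\mathrm{Hom}(X,Y)$ is the dual of a Banach space $\mathrm{Hom}(X,Y)_*$. Functors between W*-categories are linear and *-preserving; they are normal if they are ultraweakly continuous on morphism spaces. A monoidal W*-category is a W*-category with a monoidal structure $(\otimes,\mathbb 1)$ whose tensor product is a *-bifunctor that is linear and ultraweakly continuous in each variable. It is concrete if it comes with a normal strong monoidal functor to the category $\mathrm{Hilb}$ of Hilbert spaces and bounded operators with the completed tensor product; the Hilbert space underlying an object $H$ is denoted $\mathcal H$. The *strong topology on $\mathrm{End}(X)$ is generated by the seminorms $a\mapsto\varphi(a^*a)^{1/2}$ and $a\mapsto\varphi(aa^*)^{1/2}$, $\varphi$ a positive element of $\mathrm{End}(X)_*$. An object $\bar H$ is a *strong left dual of $H$ if, with $x$ running over $\mathrm{Hom}(H\otimes\bar H,\mathbb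 1)$ and $y$ over $\mathrm{Hom}(\mathbb 1,\bar H\otimes H)$, the set of all $(x\otimes\mathrm{id}_H)\circ(\mathrm{id}_H\otimes y)$ is *strongly dense in $\mathrm{End}(H)$ and the set of all $(\mathrm{id}_{\bar H}\otimes x)\circ(y\otimes\mathrm{id}_{\bar H})$ is *strongly dense in $\mathrm{End}(\bar H)$. A monoidal W*-category is *strongly rigid if every object has a *strong left dual. Proposition. Let $(\mathcal C,\otimes,\mathbb 1)$ be a *strongly rigid concrete monoidal W*-category, and let $c$ be a unitary braiding on $\mathcal C$. Then $c$ is bi-regular, that is, it is regular both on $(\mathcal C,\otimes,\mathbb 1)$ and on $(\mathcal C,\otimes^{\mathrm{op}},\mathbb 1)$: $c$ is unitary and, for all objects $H,K$ of $\mathcal C$, $$[(\mathrm{id}\otimes\omega)(c_{H,K})\mid\omega\in B(\mathcal K,\mathcal H)_*]=\mathcal K(\mathcal H,\mathcal K)=[(\omega\otimes\mathrm{id})(c_{K,H})\mid\omega\in B(\mathcal K,\mathcal H)_*],$$ where $[\,\cdot\,]$ is the norm closed linear span, $\mathcal K(\mathcal H,\mathcal K)$ is the space of compact operators $\mathcal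 H\to\mathcal K$, $B(\mathcal K,\mathcal H)_*$ is the space of normal functionals on the bounded operators $\mathcal K\to\mathcal H$, and $c_{H,K}$ is regarded as a bounded operator $\mathcal H\otimes\mathcal K\to\mathcal K\otimes\mathcal H$. -/

import Mathlib

open CategoryTheory MonoidalCategory TensorProduct
open scoped ComplexOrder InnerProductSpace

universe w v u v' u'

/-! ### The completed tensor product of Hilbert spaces -/

section HilbertTensor

variable {H K L M H' K' L' : Type*}
  [NormedAddCommGroup H] [InnerProductSpace ℂ H]
  [NormedAddCommGroup K] [InnerProductSpace ℂ K]
  [NormedAddCommGroup L] [InnerProductSpace ℂ L]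
  [NormedAddCommGroup M] [InnerProductSpace ℂ M]
  [NormedAddCommGroup H'] [InnerProductSpace ℂ H']
  [NormedAddCommGroup K'] [InnerProductSpace ℂ K']
  [NormedAddCommGroup L'] [InnerProductSpace ℂ L']

/-- The Hilbert space tensor product: the completion of the algebraic tensor product with respect to
the inner product `⟪a ⊗ b, a' ⊗ b'⟫ = ⟪a, a'⟫ * ⟪b, b'⟫`. -/
def HilbertTensor (H K : Type*) [NormedAddCommGroup H] [InnerProductSpace ℂ H]
    [NormedAddCommGroup K] [InnerProductSpace ℂ K] : Type _ :=
  UniformSpace.Completion (H ⊗[ℂ] K)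

noncomputable instance : NormedAddCommGroup (HilbertTensor H K) :=
  inferInstanceAs (NormedAddCommGroup (UniformSpace.Completion (H ⊗[ℂ] K)))

noncomputable instance : InnerProductSpace ℂ (HilbertTensor H K) :=
  inferInstanceAs (InnerProductSpace ℂ (UniformSpace.Completion (H ⊗[ℂ] K)))

instance : CompleteSpace (HilbertTensor H K) :=
  inferInstanceAs (CompleteSpace (UniformSpace.Completion (H ⊗[ℂ] K)))

/-- The inclusion of the algebraic tensor product. -/
noncomputable def toHilbertTensor (H K : Type*) [NormedAddCommGroup H] [InnerProductSpace ℂ H]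
    [NormedAddCommGroup K] [InnerProductSpace ℂ K] : H ⊗[ℂ] K →ₗᵢ[ℂ] HilbertTensor H K :=
  (UniformSpace.Completion.toComplₗᵢ : H ⊗[ℂ] K →ₗᵢ[ℂ] UniformSpace.Completion (H ⊗[ℂ] K))

theorem toHilbertTensor_dense : DenseRange (toHilbertTensor H K) :=
  UniformSpace.Completion.denseRange_coe

/-- The elementary tensor `a ⊗ b` in the Hilbert space tensor product. -/
noncomputable def pureTensor (a : H) (b : K) : HilbertTensor H K :=
  toHilbertTensor H K (a ⊗ₜ[ℂ] b)

@[simp]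
theorem toHilbertTensor_tmul (a : H) (b : K) :
    toHilbertTensor H K (a ⊗ₜ[ℂ] b) = pureTensor a b := rfl

/-- The bounded bilinear map `a ↦ b ↦ a ⊗ b`. -/
noncomputable def pureTensorL (H K : Type*) [NormedAddCommGroup H] [InnerProductSpace ℂ H]
    [NormedAddCommGroup K] [InnerProductSpace ℂ K] : H →L[ℂ] K →L[ℂ] HilbertTensor H K :=
  (ContinuousLinearMap.compL ℂ K (H ⊗[ℂ] K) (HilbertTensor H K)
    (toHilbertTensor H K).toContinuousLinearMap).comp (TensorProduct.mkL ℂ H K)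

@[simp]
theorem pureTensorL_apply (a : H) (b : K) : pureTensorL H K a b = pureTensor a b := rfl

theorem pureTensor_smul_left (z : ℂ) (a : H) (b : K) :
    pureTensor (z • a) b = z • pureTensor a b := by
  rw [← pureTensorL_apply, map_smul]; rfl

theorem pureTensor_smul_right (z : ℂ) (a : H) (b : K) :
    pureTensor a (z • b) = z • pureTensor a b := by
  rw [← pureTensorL_apply, map_smul]; rfl

theorem inner_pureTensor (a a' : H) (b b' : K) :
    ⟪pureTensor a b, pureTensor a' b'⟫_ℂ = ⟪a, a'⟫_ℂ * ⟪b, b'⟫_ℂ := by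
  rw [pureTensor, pureTensor, LinearIsometry.inner_map_map, TensorProduct.inner_tmul]

/-- Operators on a Hilbert space tensor product are determined on elementary tensors. -/
theorem hilbertTensor_ext {E : Type*} [NormedAddCommGroup E] [NormedSpace ℂ E]
    {f g : HilbertTensor H K →L[ℂ] E}
    (h : ∀ a b, f (pureTensor a b) = g (pureTensor a b)) : f = g := by
  have key : (f : HilbertTensor H K → E) = g := by
    refine toHilbertTensor_dense.equalizer f.continuous g.continuous (funext fun x => ?_)
    simp only [Function.comp_apply]
    induction x using TensorProduct.induction_on with
    | zero => simp
    | tmul a b => exact h a b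
    | add x y hx hy => rw [map_add, map_add, map_add, hx, hy]
  exact DFunLike.coe_injective key

theorem hilbertTensor_ext₃ {E : Type*} [NormedAddCommGroup E] [NormedSpace ℂ E]
    {f g : HilbertTensor (HilbertTensor H K) L →L[ℂ] E}
    (h : ∀ a b c, f (pureTensor (pureTensor a b) c) = g (pureTensor (pureTensor a b) c)) :
    f = g := by
  refine hilbertTensor_ext fun x c => ?_
  have : f.comp ((pureTensorL (HilbertTensor H K) L).flip c) =
      g.comp ((pureTensorL (HilbertTensor H K) L).flip c) :=
    hilbertTensor_ext fun a b => h a b c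
  exact DFunLike.congr_fun this x

theorem hilbertTensor_ext₄ {E : Type*} [NormedAddCommGroup E] [NormedSpace ℂ E]
    {f g : HilbertTensor (HilbertTensor (HilbertTensor H K) L) M →L[ℂ] E}
    (h : ∀ a b c d, f (pureTensor (pureTensor (pureTensor a b) c) d) =
      g (pureTensor (pureTensor (pureTensor a b) c) d)) :
    f = g := by
  refine hilbertTensor_ext fun x d => ?_
  have : f.comp ((pureTensorL (HilbertTensor (HilbertTensor H K) L) M).flip d) =
      g.comp ((pureTensorL (HilbertTensor (HilbertTensor H K) L) M).flip d) :=
    hilbertTensor_ext₃ fun a b c => h a b c d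
  exact DFunLike.congr_fun this x

/-- The operator `f ⊗ g` between Hilbert space tensor products. -/
noncomputable def hilbertTensorMap (f : H →L[ℂ] H') (g : K →L[ℂ] K') :
    HilbertTensor H K →L[ℂ] HilbertTensor H' K' :=
  ((toHilbertTensor H' K').toContinuousLinearMap.comp (TensorProduct.mapL f g)).extend
    (toHilbertTensor H K).toContinuousLinearMap

@[simp]
theorem hilbertTensorMap_pure (f : H →L[ℂ] H') (g : K →L[ℂ] K') (a : H) (b : K) :
    hilbertTensorMap f g (pureTensor a b) = pureTensor (f a) (g b) := by
  have hd : DenseRange (toHilbertTensor H K).toContinuousLinearMap := toHilbertTensor_dense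
  have hu : IsUniformInducing (toHilbertTensor H K).toContinuousLinearMap :=
    (toHilbertTensor H K).isometry.isUniformInducing
  have h := ContinuousLinearMap.extend_eq
    ((toHilbertTensor H' K').toContinuousLinearMap.comp (TensorProduct.mapL f g)) hd hu
    (a ⊗ₜ[ℂ] b)
  rw [ContinuousLinearMap.comp_apply, TensorProduct.mapL_tmul] at h
  exact h

/-- `(H ⊗ K) ⊗ L → (H ⊗̂ K) ⊗̂ L`. -/
noncomputable def tripleLeft (H K L : Type*) [NormedAddCommGroup H] [InnerProductSpace ℂ H]
    [NormedAddCommGroup K] [InnerProductSpace ℂ K] [NormedAddCommGroup L] [InnerProductSpace ℂ L] :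
    (H ⊗[ℂ] K) ⊗[ℂ] L →ₗᵢ[ℂ] HilbertTensor (HilbertTensor H K) L :=
  (toHilbertTensor (HilbertTensor H K) L).comp ((toHilbertTensor H K).rTensor L)

/-- `H ⊗ (K ⊗ L) → H ⊗̂ (K ⊗̂ L)`. -/
noncomputable def tripleRight (H K L : Type*) [NormedAddCommGroup H] [InnerProductSpace ℂ H]
    [NormedAddCommGroup K] [InnerProductSpace ℂ K] [NormedAddCommGroup L] [InnerProductSpace ℂ L] :
    H ⊗[ℂ] (K ⊗[ℂ] L) →ₗᵢ[ℂ] HilbertTensor H (HilbertTensor K L) :=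
  (toHilbertTensor H (HilbertTensor K L)).comp ((toHilbertTensor K L).lTensor H)

theorem dense_of_pureTensor_mem {S : Submodule ℂ (HilbertTensor H K)}
    (h : ∀ a b, pureTensor a b ∈ S.topologicalClosure) : Dense (S : Set (HilbertTensor H K)) := by
  rw [Submodule.dense_iff_topologicalClosure_eq_top, eq_top_iff]
  rintro x -
  refine toHilbertTensor_dense.induction_on x S.isClosed_topologicalClosure fun x => ?_
  induction x using TensorProduct.induction_on with
  | zero => simp
  | tmul a b => exact h a b
  | add x y hx hy => rw [map_add]; exact add_mem hx hy

theorem tripleLeft_dense : DenseRange (tripleLeft H K L) := by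
  refine dense_of_pureTensor_mem (S := LinearMap.range (tripleLeft H K L).toLinearMap) ?_
  intro x c
  refine toHilbertTensor_dense.induction_on
    (p := fun x => pureTensor x c ∈
      (LinearMap.range (tripleLeft H K L).toLinearMap).topologicalClosure) x ?_ fun x => ?_
  · exact (Submodule.isClosed_topologicalClosure _).preimage
      ((pureTensorL (HilbertTensor H K) L).flip c).continuous
  · exact Submodule.le_topologicalClosure _ ⟨x ⊗ₜ c, rfl⟩

theorem tripleRight_dense : DenseRange (tripleRight H K L) := by
  refine dense_of_pureTensor_mem (S := LinearMap.range (tripleRight H K L).toLinearMap) ?_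
  intro a x
  refine toHilbertTensor_dense.induction_on
    (p := fun x => pureTensor a x ∈
      (LinearMap.range (tripleRight H K L).toLinearMap).topologicalClosure) x ?_ fun x => ?_
  · exact (Submodule.isClosed_topologicalClosure _).preimage
      (pureTensorL H (HilbertTensor K L) a).continuous
  · exact Submodule.le_topologicalClosure _ ⟨a ⊗ₜ x, rfl⟩

theorem norm_tripleRight_assoc (x : (H ⊗[ℂ] K) ⊗[ℂ] L) :
    ‖(tripleRight H K L).toLinearMap (TensorProduct.assoc ℂ H K L x)‖ =
      ‖(tripleLeft H K L).toLinearMap x‖ :=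
  ((tripleRight H K L).norm_map _).trans
    (((TensorProduct.assocIsometry ℂ H K L).norm_map x).trans ((tripleLeft H K L).norm_map x).symm)

/-- The unitary `(H ⊗̂ K) ⊗̂ L ≃ H ⊗̂ (K ⊗̂ L)`. -/
noncomputable def hilbertAssoc (H K L : Type*) [NormedAddCommGroup H] [InnerProductSpace ℂ H]
    [NormedAddCommGroup K] [InnerProductSpace ℂ K] [NormedAddCommGroup L] [InnerProductSpace ℂ L] :
    HilbertTensor (HilbertTensor H K) L ≃ₗᵢ[ℂ] HilbertTensor H (HilbertTensor K L) :=
  (TensorProduct.assoc ℂ H K L).extendOfIsometry (tripleLeft H K L).toLinearMap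
    (tripleRight H K L).toLinearMap tripleLeft_dense tripleRight_dense norm_tripleRight_assoc

@[simp]
theorem hilbertAssoc_pure (a : H) (b : K) (c : L) :
    hilbertAssoc H K L (pureTensor (pureTensor a b) c) = pureTensor a (pureTensor b c) :=
  LinearEquiv.extendOfIsometry_eq (TensorProduct.assoc ℂ H K L) (tripleLeft H K L).toLinearMap
    (tripleRight H K L).toLinearMap tripleLeft_dense tripleRight_dense norm_tripleRight_assoc
    ((a ⊗ₜ b) ⊗ₜ c)

/-- The one-dimensional Hilbert space `ℂ`, in any universe. -/
abbrev HilbertUnit : Type w := EuclideanSpace ℂ PUnit.{w + 1}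

/-- The identification of the one-dimensional Hilbert space with `ℂ`. -/
noncomputable def hilbertUnitIso : HilbertUnit.{w} ≃ₗᵢ[ℂ] ℂ where
  toFun x := x PUnit.unit
  invFun z := WithLp.toLp 2 fun _ => z
  map_add' _ _ := rfl
  map_smul' _ _ := rfl
  left_inv x := by ext; rfl
  right_inv _ := rfl
  norm_map' x := by
    change ‖x PUnit.unit‖ = ‖x‖
    simp [EuclideanSpace.norm_eq]

/-- The unitary `ℂ ⊗ H ≃ H` on the algebraic tensor product. -/
noncomputable def algLid (H : Type*) [NormedAddCommGroup H] [InnerProductSpace ℂ H] :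
    HilbertUnit.{w} ⊗[ℂ] H ≃ₗᵢ[ℂ] H :=
  (TensorProduct.congrIsometry hilbertUnitIso (.refl ℂ H)).trans (TensorProduct.lidIsometry ℂ H)

/-- The unitary `H ⊗ ℂ ≃ H` on the algebraic tensor product. -/
noncomputable def algRid (H : Type*) [NormedAddCommGroup H] [InnerProductSpace ℂ H] :
    H ⊗[ℂ] HilbertUnit.{w} ≃ₗᵢ[ℂ] H :=
  (TensorProduct.congrIsometry (.refl ℂ H) hilbertUnitIso).trans (TensorProduct.ridIsometry ℂ H)

theorem norm_algLid (x : HilbertUnit.{w} ⊗[ℂ] H) :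
    ‖(LinearMap.id : H →ₗ[ℂ] H) ((algLid H).toLinearEquiv x)‖ =
      ‖(toHilbertTensor HilbertUnit.{w} H).toLinearMap x‖ :=
  ((algLid H).norm_map x).trans ((toHilbertTensor HilbertUnit.{w} H).norm_map x).symm

theorem norm_algRid (x : H ⊗[ℂ] HilbertUnit.{w}) :
    ‖(LinearMap.id : H →ₗ[ℂ] H) ((algRid H).toLinearEquiv x)‖ =
      ‖(toHilbertTensor H HilbertUnit.{w}).toLinearMap x‖ :=
  ((algRid H).norm_map x).trans ((toHilbertTensor H HilbertUnit.{w}).norm_map x).symm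

/-- The unitary `ℂ ⊗̂ H ≃ H`. -/
noncomputable def hilbertLid (H : Type*) [NormedAddCommGroup H] [InnerProductSpace ℂ H]
    [CompleteSpace H] : HilbertTensor HilbertUnit.{w} H ≃ₗᵢ[ℂ] H :=
  (algLid H).toLinearEquiv.extendOfIsometry (toHilbertTensor HilbertUnit.{w} H).toLinearMap
    LinearMap.id toHilbertTensor_dense denseRange_id norm_algLid

/-- The unitary `H ⊗̂ ℂ ≃ H`. -/
noncomputable def hilbertRid (H : Type*) [NormedAddCommGroup H] [InnerProductSpace ℂ H]
    [CompleteSpace H] : HilbertTensor H HilbertUnit.{w} ≃ₗᵢ[ℂ] H :=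
  (algRid H).toLinearEquiv.extendOfIsometry (toHilbertTensor H HilbertUnit.{w}).toLinearMap
    LinearMap.id toHilbertTensor_dense denseRange_id norm_algRid

@[simp]
theorem hilbertLid_pure [CompleteSpace H] (z : HilbertUnit.{w}) (a : H) :
    hilbertLid H (pureTensor z a) = hilbertUnitIso z • a :=
  LinearEquiv.extendOfIsometry_eq _ (toHilbertTensor HilbertUnit.{w} H).toLinearMap LinearMap.id
    toHilbertTensor_dense denseRange_id norm_algLid (z ⊗ₜ[ℂ] a)

@[simp]
theorem hilbertRid_pure [CompleteSpace H] (z : HilbertUnit.{w}) (a : H) :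
    hilbertRid H (pureTensor a z) = hilbertUnitIso z • a :=
  LinearEquiv.extendOfIsometry_eq _ (toHilbertTensor H HilbertUnit.{w}).toLinearMap LinearMap.id
    toHilbertTensor_dense denseRange_id norm_algRid (a ⊗ₜ[ℂ] z)

theorem hilbertTensorMap_comp {H'' K'' : Type*}
    [NormedAddCommGroup H''] [InnerProductSpace ℂ H'']
    [NormedAddCommGroup K''] [InnerProductSpace ℂ K'']
    (f : H →L[ℂ] H') (g : K →L[ℂ] K') (f' : H' →L[ℂ] H'') (g' : K' →L[ℂ] K'') :
    (hilbertTensorMap f' g').comp (hilbertTensorMap f g) =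
      hilbertTensorMap (f'.comp f) (g'.comp g) :=
  hilbertTensor_ext fun a b => by simp

/-- A unitary operator as a bounded operator. -/
def unitaryOp (f : H ≃ₗᵢ[ℂ] K) : H →L[ℂ] K := f.toContinuousLinearEquiv.toContinuousLinearMap

@[simp]
theorem unitaryOp_apply (f : H ≃ₗᵢ[ℂ] K) (a : H) : unitaryOp f a = f a := rfl

theorem hilbertAssoc_naturality (f : H →L[ℂ] H') (g : K →L[ℂ] K') (h : L →L[ℂ] L') :
    (unitaryOp (hilbertAssoc H' K' L')).comp (hilbertTensorMap (hilbertTensorMap f g) h) =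
      (hilbertTensorMap f (hilbertTensorMap g h)).comp (unitaryOp (hilbertAssoc H K L)) :=
  hilbertTensor_ext₃ fun a b c => by simp

theorem hilbertLid_naturality [CompleteSpace H] [CompleteSpace H'] (f : H →L[ℂ] H') :
    (unitaryOp (hilbertLid H')).comp
        (hilbertTensorMap (ContinuousLinearMap.id ℂ HilbertUnit.{w}) f) =
      f.comp (unitaryOp (hilbertLid H)) :=
  hilbertTensor_ext fun z a => by simp

theorem hilbertRid_naturality [CompleteSpace H] [CompleteSpace H'] (f : H →L[ℂ] H') :
    (unitaryOp (hilbertRid H')).comp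
        (hilbertTensorMap f (ContinuousLinearMap.id ℂ HilbertUnit.{w})) =
      f.comp (unitaryOp (hilbertRid H)) :=
  hilbertTensor_ext fun z a => by simp

theorem hilbert_pentagon :
    (hilbertTensorMap (ContinuousLinearMap.id ℂ H) (unitaryOp (hilbertAssoc K L M))).comp
      ((unitaryOp (hilbertAssoc H (HilbertTensor K L) M)).comp
        (hilbertTensorMap (unitaryOp (hilbertAssoc H K L)) (ContinuousLinearMap.id ℂ M))) =
    (unitaryOp (hilbertAssoc H K (HilbertTensor L M))).comp
      (unitaryOp (hilbertAssoc (HilbertTensor H K) L M)) :=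
  hilbertTensor_ext₄ fun a b c d => by simp

theorem hilbert_triangle [CompleteSpace H] [CompleteSpace K] :
    (hilbertTensorMap (ContinuousLinearMap.id ℂ H) (unitaryOp (hilbertLid K))).comp
      (unitaryOp (hilbertAssoc H HilbertUnit.{w} K)) =
    hilbertTensorMap (unitaryOp (hilbertRid H)) (ContinuousLinearMap.id ℂ K) :=
  hilbertTensor_ext₃ fun a z b => by simp [pureTensor_smul_left, pureTensor_smul_right]

end HilbertTensor

/-! ### The monoidal category of Hilbert spaces -/

/-- Complex Hilbert spaces. -/
structure Hilb : Type (w + 1) where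
  carrier : Type w
  [normedAddCommGroup : NormedAddCommGroup carrier]
  [innerProductSpace : InnerProductSpace ℂ carrier]
  [completeSpace : CompleteSpace carrier]

namespace Hilb

instance : CoeSort Hilb.{w} (Type w) := ⟨Hilb.carrier⟩

attribute [instance] normedAddCommGroup innerProductSpace completeSpace

/-- Morphisms of Hilbert spaces are the bounded linear operators. -/
instance : Category Hilb.{w} where
  Hom H K := H →L[ℂ] K
  id H := ContinuousLinearMap.id ℂ H
  comp f g := ContinuousLinearMap.comp g f

/-- A unitary operator, seen as an isomorphism of `Hilb`. -/
def isoOfUnitary {H K : Hilb.{w}} (f : H ≃ₗᵢ[ℂ] K) : H ≅ K where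
  hom := unitaryOp f
  inv := unitaryOp f.symm
  hom_inv_id := ContinuousLinearMap.ext fun x => f.symm_apply_apply x
  inv_hom_id := ContinuousLinearMap.ext fun x => f.apply_symm_apply x

noncomputable instance : MonoidalCategoryStruct Hilb.{w} where
  tensorObj H K := ⟨HilbertTensor H K⟩
  whiskerLeft H _ _ f := hilbertTensorMap (ContinuousLinearMap.id ℂ H) f
  whiskerRight f K := hilbertTensorMap f (ContinuousLinearMap.id ℂ K)
  tensorHom f g := hilbertTensorMap f g
  tensorUnit := ⟨HilbertUnit.{w}⟩
  associator H K L := isoOfUnitary (hilbertAssoc H K L)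
  leftUnitor H := isoOfUnitary (hilbertLid H)
  rightUnitor H := isoOfUnitary (hilbertRid H)

noncomputable instance : MonoidalCategory Hilb.{w} :=
  MonoidalCategory.ofTensorHom
    (id_tensorHom_id := fun H K => hilbertTensor_ext fun a b =>
      hilbertTensorMap_pure (ContinuousLinearMap.id ℂ H) (ContinuousLinearMap.id ℂ K) a b)
    (id_tensorHom := fun _ _ _ _ => rfl)
    (tensorHom_id := fun _ _ => rfl)
    (tensorHom_comp_tensorHom := fun f₁ f₂ g₁ g₂ =>
      hilbertTensorMap_comp f₁ f₂ g₁ g₂)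
    (associator_naturality := fun f₁ f₂ f₃ =>
      hilbertAssoc_naturality f₁ f₂ f₃)
    (leftUnitor_naturality := fun f => hilbertLid_naturality f)
    (rightUnitor_naturality := fun f => hilbertRid_naturality f)
    (pentagon := fun _ _ _ _ => hilbert_pentagon)
    (triangle := fun _ _ => hilbert_triangle)

end Hilb

/-! ### C*-categories and W*-categories -/

/-- A C*-category: the morphism spaces are complex Banach spaces, composition is bilinear and
submultiplicative, and there are isometric conjugate-linear involutions `f ↦ f†` that reverse
composition and satisfy `‖f† ∘ f‖ = ‖f‖ ^ 2`. -/
class CStarCategory (C : Type u) [Category.{v} C] where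
  [homNormedAddCommGroup : ∀ X Y : C, NormedAddCommGroup (X ⟶ Y)]
  [homNormedSpace : ∀ X Y : C, NormedSpace ℂ (X ⟶ Y)]
  [homCompleteSpace : ∀ X Y : C, CompleteSpace (X ⟶ Y)]
  add_comp' : ∀ {X Y Z : C} (f f' : X ⟶ Y) (g : Y ⟶ Z), (f + f') ≫ g = f ≫ g + f' ≫ g
  comp_add' : ∀ {X Y Z : C} (f : X ⟶ Y) (g g' : Y ⟶ Z), f ≫ (g + g') = f ≫ g + f ≫ g'
  smul_comp' : ∀ {X Y Z : C} (z : ℂ) (f : X ⟶ Y) (g : Y ⟶ Z), (z • f) ≫ g = z • (f ≫ g)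
  comp_smul' : ∀ {X Y Z : C} (z : ℂ) (f : X ⟶ Y) (g : Y ⟶ Z), f ≫ (z • g) = z • (f ≫ g)
  norm_comp_le : ∀ {X Y Z : C} (f : X ⟶ Y) (g : Y ⟶ Z), ‖f ≫ g‖ ≤ ‖g‖ * ‖f‖
  /-- The involution `f ↦ f†`. -/
  dagger : ∀ {X Y : C}, (X ⟶ Y) → (Y ⟶ X)
  dagger_add : ∀ {X Y : C} (f g : X ⟶ Y), dagger (f + g) = dagger f + dagger g
  dagger_smul : ∀ {X Y : C} (z : ℂ) (f : X ⟶ Y), dagger (z • f) = star z • dagger f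
  dagger_dagger : ∀ {X Y : C} (f : X ⟶ Y), dagger (dagger f) = f
  dagger_comp : ∀ {X Y Z : C} (f : X ⟶ Y) (g : Y ⟶ Z), dagger (f ≫ g) = dagger g ≫ dagger f
  norm_dagger : ∀ {X Y : C} (f : X ⟶ Y), ‖dagger f‖ = ‖f‖
  norm_comp_dagger : ∀ {X Y : C} (f : X ⟶ Y), ‖f ≫ dagger f‖ = ‖f‖ ^ 2

attribute [reducible, instance] CStarCategory.homNormedAddCommGroup CStarCategory.homNormedSpace

attribute [instance] CStarCategory.homCompleteSpace

open CStarCategory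

/-- A morphism `f` is unitary if `f† ∘ f` and `f ∘ f†` are identities. -/
def IsUnitaryHom {C : Type u} [Category.{v} C] [CStarCategory C] {X Y : C} (f : X ⟶ Y) : Prop :=
  f ≫ dagger f = 𝟙 X ∧ dagger f ≫ f = 𝟙 Y

/-- A W*-category: a C*-category in which every space of morphisms `X ⟶ Y` is the dual of a Banach
space `PreHom X Y`. -/
class WStarCategory (C : Type u) [Category.{v} C] extends CStarCategory C where
  /-- The predual of the space of morphisms. -/
  PreHom : C → C → Type v
  [preHomNormedAddCommGroup : ∀ X Y : C, NormedAddCommGroup (PreHom X Y)]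
  [preHomNormedSpace : ∀ X Y : C, NormedSpace ℂ (PreHom X Y)]
  [preHomCompleteSpace : ∀ X Y : C, CompleteSpace (PreHom X Y)]
  /-- The identification of the space of morphisms with the dual of its predual. -/
  homEquivDual : ∀ X Y : C, (X ⟶ Y) ≃ₗᵢ[ℂ] StrongDual ℂ (PreHom X Y)

attribute [reducible, instance] WStarCategory.preHomNormedAddCommGroup
  WStarCategory.preHomNormedSpace

attribute [instance] WStarCategory.preHomCompleteSpace

open WStarCategory

/-- The value `φ(a)` of an element `φ` of the predual at a morphism `a`. -/
noncomputable def pairing {C : Type u} [Category.{v} C] [WStarCategory C] {X Y : C}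
    (φ : PreHom X Y) (a : X ⟶ Y) : ℂ :=
  homEquivDual X Y a φ

/-- The ultraweak topology on a space of morphisms, induced by the predual. -/
@[reducible]
noncomputable def ultraweakTopology {C : Type u} [Category.{v} C] [WStarCategory C] (X Y : C) :
    TopologicalSpace (X ⟶ Y) :=
  ⨅ φ : PreHom X Y, TopologicalSpace.induced (pairing φ) inferInstance

/-- A map between spaces of morphisms is normal if it is continuous for the ultraweak topologies. -/
def IsNormalMap {C : Type u} [Category.{v} C] [WStarCategory C]
    {D : Type u'} [Category.{v'} D] [WStarCategory D] {X Y : C} {X' Y' : D}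
    (T : (X ⟶ Y) → (X' ⟶ Y')) : Prop :=
  @Continuous _ _ (ultraweakTopology X Y) (ultraweakTopology X' Y') T

/-- The positive elements of the predual of `End(X)`. -/
def IsPositiveNormal {C : Type u} [Category.{v} C] [WStarCategory C] {X : C} (φ : PreHom X X) :
    Prop :=
  ∀ a : X ⟶ X, 0 ≤ pairing φ (a ≫ dagger a)

/-- The *strong topology on `End(X)`: the locally convex topology generated by the seminorms
`a ↦ φ(a† ∘ a) ^ (1/2)` and `a ↦ φ(a ∘ a†) ^ (1/2)`, `φ` a positive element of the predual. The open
semi-balls of these seminorms form a subbase. -/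
@[reducible]
def starStrongTopology {C : Type u} [Category.{v} C] [WStarCategory C] (X : C) :
    TopologicalSpace (X ⟶ X) :=
  TopologicalSpace.generateFrom
    {U | ∃ φ : PreHom X X, IsPositiveNormal φ ∧ ∃ (b : X ⟶ X) (ε : ℝ),
      U = {a | √(pairing φ ((a - b) ≫ dagger (a - b))).re < ε} ∨
      U = {a | √(pairing φ (dagger (a - b) ≫ (a - b))).re < ε}}

/-- A normal linear *-functor between W*-categories. -/
structure IsNormalStarFunctor {C : Type u} [Category.{v} C] [WStarCategory C]
    {D : Type u'} [Category.{v'} D] [WStarCategory D] (F : C ⥤ D) : Prop where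
  map_add : ∀ {X Y : C} (f g : X ⟶ Y), F.map (f + g) = F.map f + F.map g
  map_smul : ∀ {X Y : C} (z : ℂ) (f : X ⟶ Y), F.map (z • f) = z • F.map f
  map_dagger : ∀ {X Y : C} (f : X ⟶ Y), F.map (dagger f) = dagger (F.map f)
  normal : ∀ X Y : C, IsNormalMap fun f : X ⟶ Y => F.map f

/-- A monoidal W*-category: the tensor product is a normal *-bifunctor, that is, it is linear and
ultraweakly continuous in each variable and compatible with the involutions. -/
class MonoidalWStarCategory (C : Type u) [Category.{v} C] [WStarCategory C]
    [MonoidalCategory C] : Prop where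
  add_tensor : ∀ {X Y X' Y' : C} (f g : X ⟶ Y) (h : X' ⟶ Y'), (f + g) ⊗ₘ h = f ⊗ₘ h + g ⊗ₘ h
  tensor_add : ∀ {X Y X' Y' : C} (f : X ⟶ Y) (g h : X' ⟶ Y'), f ⊗ₘ (g + h) = f ⊗ₘ g + f ⊗ₘ h
  smul_tensor : ∀ {X Y X' Y' : C} (z : ℂ) (f : X ⟶ Y) (g : X' ⟶ Y'),
    (z • f) ⊗ₘ g = z • (f ⊗ₘ g)
  tensor_smul : ∀ {X Y X' Y' : C} (z : ℂ) (f : X ⟶ Y) (g : X' ⟶ Y'),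
    f ⊗ₘ (z • g) = z • (f ⊗ₘ g)
  dagger_tensor : ∀ {X Y X' Y' : C} (f : X ⟶ Y) (g : X' ⟶ Y'),
    dagger (f ⊗ₘ g) = dagger f ⊗ₘ dagger g
  normal_left : ∀ {X Y X' Y' : C} (g : X' ⟶ Y'), IsNormalMap fun f : X ⟶ Y => f ⊗ₘ g
  normal_right : ∀ {X Y X' Y' : C} (f : X ⟶ Y), IsNormalMap fun g : X' ⟶ Y' => f ⊗ₘ g

/-! ### *strongly rigid categories -/

/-- `H'` is a *strong left dual of `H`: the operators `(x ⊗ id) ∘ (id ⊗ y)` and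
`(id ⊗ x) ∘ (y ⊗ id)`, with `x : H ⊗ H' ⟶ 𝟙` and `y : 𝟙 ⟶ H' ⊗ H`, are *strongly dense in `End(H)`
and in `End(H')`, respectively. -/
def IsStarStrongLeftDual {C : Type u} [Category.{v} C] [WStarCategory C] [MonoidalCategory C]
    (H H' : C) : Prop :=
  @Dense _ (starStrongTopology H)
    {a | ∃ (x : H ⊗ H' ⟶ 𝟙_ C) (y : 𝟙_ C ⟶ H' ⊗ H),
      a = (ρ_ H).inv ≫ H ◁ y ≫ (α_ H H' H).inv ≫ x ▷ H ≫ (λ_ H).hom} ∧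
  @Dense _ (starStrongTopology H')
    {a | ∃ (x : H ⊗ H' ⟶ 𝟙_ C) (y : 𝟙_ C ⟶ H' ⊗ H),
      a = (λ_ H').inv ≫ y ▷ H' ≫ (α_ H' H H').hom ≫ H' ◁ x ≫ (ρ_ H').hom}

/-- A monoidal W*-category is *strongly rigid if every object has a *strong left dual. -/
def IsStarStronglyRigid (C : Type u) [Category.{v} C] [WStarCategory C] [MonoidalCategory C] :
    Prop :=
  ∀ H : C, ∃ H' : C, IsStarStrongLeftDual H H'

/-! ### Hilbert spaces form a W*-category -/

/-- The functional `T ↦ ⟪η, T ξ⟫` on bounded operators. -/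
noncomputable def vectorFunctional {H K : Type*} [NormedAddCommGroup H] [InnerProductSpace ℂ H]
    [NormedAddCommGroup K] [InnerProductSpace ℂ K] (ξ : H) (η : K) : StrongDual ℂ (H →L[ℂ] K) :=
  (innerSL ℂ η).comp (ContinuousLinearMap.apply ℂ K ξ)

@[simp]
theorem vectorFunctional_apply {H K : Type*} [NormedAddCommGroup H] [InnerProductSpace ℂ H]
    [NormedAddCommGroup K] [InnerProductSpace ℂ K] (ξ : H) (η : K) (T : H →L[ℂ] K) :
    vectorFunctional ξ η T = ⟪η, T ξ⟫_ℂ := rfl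

/-- The closed linear span `[X]` of a subset of a normed space. -/
noncomputable def closedSpan {V : Type*} [NormedAddCommGroup V] [NormedSpace ℂ V] (X : Set V) :
    Submodule ℂ V :=
  (Submodule.span ℂ X).topologicalClosure

/-- The closed linear span of a subset of a normed space, as a normed space. -/
def ClosedSpan {V : Type*} [NormedAddCommGroup V] [NormedSpace ℂ V] (X : Set V) : Type _ :=
  ↥(closedSpan X)

namespace ClosedSpan

variable {V : Type*} [NormedAddCommGroup V] [NormedSpace ℂ V] (X : Set V)

noncomputable instance : NormedAddCommGroup (ClosedSpan X) :=
  inferInstanceAs (NormedAddCommGroup ↥(closedSpan X))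

noncomputable instance : NormedSpace ℂ (ClosedSpan X) :=
  inferInstanceAs (NormedSpace ℂ ↥(closedSpan X))

instance [CompleteSpace V] : CompleteSpace (ClosedSpan X) :=
  (Submodule.isClosed_topologicalClosure (Submodule.span ℂ X)).completeSpace_coe

/-- The inclusion of the closed linear span. -/
noncomputable def incl : ClosedSpan X →ₗᵢ[ℂ] V := (closedSpan X).subtypeₗᵢ

variable {X}

/-- An element of `X` as an element of its closed linear span. -/
noncomputable def of (x : V) (hx : x ∈ X) : ClosedSpan X :=
  ⟨x, Submodule.le_topologicalClosure _ (Submodule.subset_span hx)⟩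

@[simp]
theorem incl_of (x : V) (hx : x ∈ X) : incl X (of x hx) = x := rfl

theorem incl_injective : Function.Injective (incl X) := (incl X).injective

/-- The inclusion of the linear span in the closed linear span. -/
def ofSpan (x : Submodule.span ℂ X) : ClosedSpan X :=
  ⟨x.1, Submodule.le_topologicalClosure (Submodule.span ℂ X) x.2⟩

theorem denseRange_ofSpan : DenseRange (ofSpan (X := X)) := by
  intro y
  have hi : IsUniformInducing (incl X) := (incl X).isometry.isUniformInducing
  have hr : incl X '' Set.range (ofSpan (X := X)) = (Submodule.span ℂ X : Set V) := by
    rw [← Set.range_comp]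
    exact Subtype.range_coe
  refine hi.isInducing.closure_eq_preimage_closure_image (Set.range ofSpan) ▸ ?_
  rw [Set.mem_preimage, hr]
  exact y.2

/-- Bounded functionals on the closed linear span are determined by their values on the set. -/
theorem ext_functional {Φ Ψ : StrongDual ℂ (ClosedSpan X)}
    (h : ∀ x hx, Φ (of x hx) = Ψ (of x hx)) : Φ = Ψ := by
  have hspan : ∀ (x : V) (hx : x ∈ Submodule.span ℂ X), Φ (ofSpan ⟨x, hx⟩) = Ψ (ofSpan ⟨x, hx⟩) := by
    intro x hx
    induction hx using Submodule.span_induction with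
    | mem x hx => exact h x hx
    | zero => exact (map_zero Φ).trans (map_zero Ψ).symm
    | add x y hx hy h1 h2 =>
      exact (map_add Φ _ _).trans ((congrArg₂ (· + ·) h1 h2).trans (map_add Ψ _ _).symm)
    | smul z x hx h1 =>
      exact (map_smul Φ z _).trans ((congrArg (z • ·) h1).trans (map_smul Ψ z _).symm)
  exact DFunLike.coe_injective
    (denseRange_ofSpan.equalizer Φ.continuous Ψ.continuous (funext fun x => hspan x.1 x.2))

end ClosedSpan

/-- The predual `B(H, K)_*` of the bounded operators: the norm closed span of the functionals
`T ↦ ⟪η, T ξ⟫`. -/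
abbrev OperatorPredual (H K : Type*) [NormedAddCommGroup H] [InnerProductSpace ℂ H]
    [NormedAddCommGroup K] [InnerProductSpace ℂ K] : Type _ :=
  ClosedSpan (Set.range fun p : H × K => vectorFunctional p.1 p.2)

section OperatorPredual

variable {H K : Type*} [NormedAddCommGroup H] [InnerProductSpace ℂ H]
  [NormedAddCommGroup K] [InnerProductSpace ℂ K]

/-- An element of the predual as a functional on bounded operators. -/
noncomputable def OperatorPredual.toFunctional :
    OperatorPredual H K →ₗᵢ[ℂ] StrongDual ℂ (H →L[ℂ] K) :=
  ClosedSpan.incl _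

/-- The functional `T ↦ ⟪η, T ξ⟫` as an element of the predual. -/
noncomputable def OperatorPredual.vector (ξ : H) (η : K) : OperatorPredual H K :=
  ClosedSpan.of (vectorFunctional ξ η) ⟨(ξ, η), rfl⟩

@[simp]
theorem OperatorPredual.toFunctional_vector (ξ : H) (η : K) :
    OperatorPredual.toFunctional (OperatorPredual.vector ξ η) = vectorFunctional ξ η := rfl

theorem OperatorPredual.ext_apply {φ ψ : OperatorPredual H K}
    (h : ∀ T, OperatorPredual.toFunctional φ T = OperatorPredual.toFunctional ψ T) : φ = ψ :=
  ClosedSpan.incl_injective (ContinuousLinearMap.ext h)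

theorem OperatorPredual.norm_vector_le (ξ : H) (η : K) :
    ‖OperatorPredual.vector ξ η‖ ≤ ‖ξ‖ * ‖η‖ := by
  rw [← OperatorPredual.toFunctional.norm_map, OperatorPredual.toFunctional_vector]
  refine ContinuousLinearMap.opNorm_le_bound _ (by positivity) fun T => ?_
  rw [vectorFunctional_apply]
  calc ‖⟪η, T ξ⟫_ℂ‖ ≤ ‖η‖ * ‖T ξ‖ := norm_inner_le_norm _ _
    _ ≤ ‖η‖ * (‖T‖ * ‖ξ‖) := by gcongr; exact T.le_opNorm ξ
    _ = ‖ξ‖ * ‖η‖ * ‖T‖ := by ring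

/-- A bounded sesquilinear form is given by a bounded operator. -/
theorem exists_operator_of_form [CompleteSpace K] (B : H → K → ℂ) (c : ℝ) (hc : 0 ≤ c)
    (hadd : ∀ ξ ξ' η, B (ξ + ξ') η = B ξ η + B ξ' η) (hsmul : ∀ (z : ℂ) ξ η, B (z • ξ) η = z * B ξ η)
    (hadd' : ∀ ξ η η', B ξ (η + η') = B ξ η + B ξ η')
    (hsmul' : ∀ (z : ℂ) ξ η, B ξ (z • η) = star z * B ξ η)
    (hB : ∀ ξ η, ‖B ξ η‖ ≤ c * ‖ξ‖ * ‖η‖) : ∃ T : H →L[ℂ] K, ∀ ξ η, ⟪η, T ξ⟫_ℂ = B ξ η := by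
  let f : H → StrongDual ℂ K := fun ξ => LinearMap.mkContinuous
    { toFun := fun η => star (B ξ η)
      map_add' := fun η η' => by simp [hadd']
      map_smul' := fun z η => by simp [hsmul'] } (c * ‖ξ‖) fun η => by simpa using hB ξ η
  have hf : ∀ ξ η, ⟪η, (InnerProductSpace.toDual ℂ K).symm (f ξ)⟫_ℂ = B ξ η := fun ξ η => by
    rw [← inner_conj_symm, InnerProductSpace.toDual_symm_apply]
    exact star_star _
  refine ⟨LinearMap.mkContinuous
    { toFun := fun ξ => (InnerProductSpace.toDual ℂ K).symm (f ξ)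
      map_add' := fun ξ ξ' => ext_inner_left ℂ fun η => by
        rw [inner_add_right, hf, hf, hf, hadd]
      map_smul' := fun z ξ => ext_inner_left ℂ fun η => by
        rw [RingHom.id_apply, inner_smul_right, hf, hf, hsmul] } c fun ξ => ?_, hf⟩
  change ‖(InnerProductSpace.toDual ℂ K).symm (f ξ)‖ ≤ _
  set y := (InnerProductSpace.toDual ℂ K).symm (f ξ) with hy
  have h := hB ξ y
  rw [← hf, ← hy, inner_self_eq_norm_sq_to_K, norm_pow, RCLike.norm_ofReal, abs_norm, sq] at h
  rcases (norm_nonneg y).eq_or_lt with h0 | h0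
  · rw [← h0]; positivity
  · exact le_of_mul_le_mul_right h h0

/-- The evaluation of the elements of the predual at a bounded operator. -/
noncomputable def operatorEval : (H →L[ℂ] K) →L[ℂ] StrongDual ℂ (OperatorPredual H K) :=
  (OperatorPredual.toFunctional (H := H) (K := K)).toContinuousLinearMap.flip

@[simp]
theorem operatorEval_apply (T : H →L[ℂ] K) (φ : OperatorPredual H K) :
    operatorEval T φ = OperatorPredual.toFunctional φ T := rfl

theorem norm_operatorEval (T : H →L[ℂ] K) : ‖operatorEval T‖ = ‖T‖ := by
  refine le_antisymm (ContinuousLinearMap.opNorm_le_bound _ (norm_nonneg _) fun φ => ?_) ?_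
  · rw [operatorEval_apply, ← OperatorPredual.toFunctional.norm_map φ, mul_comm]
    exact ContinuousLinearMap.le_opNorm _ T
  refine T.opNorm_le_bound (norm_nonneg _) fun ξ => ?_
  have h : ‖T ξ‖ * ‖T ξ‖ ≤ ‖operatorEval T‖ * ‖ξ‖ * ‖T ξ‖ := by
    calc ‖T ξ‖ * ‖T ξ‖ = ‖operatorEval T (OperatorPredual.vector ξ (T ξ))‖ := by
          rw [operatorEval_apply, OperatorPredual.toFunctional_vector, vectorFunctional_apply,
            inner_self_eq_norm_sq_to_K, norm_pow, RCLike.norm_ofReal, abs_norm, sq]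
      _ ≤ ‖operatorEval T‖ * ‖OperatorPredual.vector ξ (T ξ)‖ := ContinuousLinearMap.le_opNorm _ _
      _ ≤ ‖operatorEval T‖ * (‖ξ‖ * ‖T ξ‖) := by
          gcongr; exact OperatorPredual.norm_vector_le _ _
      _ = _ := by ring
  rcases (norm_nonneg (T ξ)).eq_or_lt with h0 | h0
  · rw [← h0]; positivity
  · exact le_of_mul_le_mul_right h h0

theorem surjective_operatorEval [CompleteSpace K] :
    Function.Surjective (operatorEval : (H →L[ℂ] K) →L[ℂ] StrongDual ℂ (OperatorPredual H K)) := by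
  intro Φ
  obtain ⟨T, hT⟩ := exists_operator_of_form (fun (ξ : H) (η : K) => Φ (OperatorPredual.vector ξ η))
    ‖Φ‖ (norm_nonneg Φ)
    (fun ξ ξ' η => by
      rw [← map_add]; congr 1
      exact OperatorPredual.ext_apply fun S => by simp)
    (fun z ξ η => by
      rw [← smul_eq_mul, ← map_smul]; congr 1
      exact OperatorPredual.ext_apply fun S => by simp)
    (fun ξ η η' => by
      rw [← map_add]; congr 1
      exact OperatorPredual.ext_apply fun S => by simp)
    (fun z ξ η => by
      rw [← smul_eq_mul, ← map_smul]; congr 1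
      exact OperatorPredual.ext_apply fun S => by simp [mul_comm])
    (fun ξ η => by
      rw [mul_assoc]
      exact (Φ.le_opNorm _).trans
        (mul_le_mul_of_nonneg_left (OperatorPredual.norm_vector_le ξ η) (norm_nonneg _)))
  refine ⟨T, ClosedSpan.ext_functional ?_⟩
  rintro _ ⟨p, rfl⟩
  exact hT p.1 p.2

/-- `B(H, K)` is the dual of `B(H, K)_*`. -/
noncomputable def operatorDuality (H K : Type*) [NormedAddCommGroup H] [InnerProductSpace ℂ H]
    [NormedAddCommGroup K] [InnerProductSpace ℂ K] [CompleteSpace K] :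
    (H →L[ℂ] K) ≃ₗᵢ[ℂ] StrongDual ℂ (OperatorPredual H K) :=
  LinearIsometryEquiv.ofSurjective
    { toLinearMap := operatorEval.toLinearMap, norm_map' := norm_operatorEval } surjective_operatorEval

end OperatorPredual

namespace Hilb

noncomputable instance (H K : Hilb.{w}) : NormedAddCommGroup (H ⟶ K) :=
  inferInstanceAs (NormedAddCommGroup (H →L[ℂ] K))

noncomputable instance (H K : Hilb.{w}) : NormedSpace ℂ (H ⟶ K) :=
  inferInstanceAs (NormedSpace ℂ (H →L[ℂ] K))

instance (H K : Hilb.{w}) : CompleteSpace (H ⟶ K) :=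
  inferInstanceAs (CompleteSpace (H →L[ℂ] K))

noncomputable instance : CStarCategory Hilb.{w} where
  add_comp' f f' g := ContinuousLinearMap.comp_add g f f'
  comp_add' f g g' := ContinuousLinearMap.add_comp g g' f
  smul_comp' z f g := ContinuousLinearMap.comp_smul g z f
  comp_smul' z f g := ContinuousLinearMap.smul_comp z g f
  norm_comp_le f g := ContinuousLinearMap.opNorm_comp_le g f
  dagger {H K} f := ContinuousLinearMap.adjoint (𝕜 := ℂ) (E := H) (F := K) f
  dagger_add f g := map_add ContinuousLinearMap.adjoint f g
  dagger_smul z f := map_smulₛₗ ContinuousLinearMap.adjoint z f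
  dagger_dagger f := ContinuousLinearMap.adjoint_adjoint f
  dagger_comp f g := ContinuousLinearMap.adjoint_comp g f
  norm_dagger f := LinearIsometryEquiv.norm_map ContinuousLinearMap.adjoint f
  norm_comp_dagger f := (ContinuousLinearMap.norm_adjoint_comp_self f).trans (sq _).symm

noncomputable instance : WStarCategory Hilb.{w} where
  PreHom H K := OperatorPredual H K
  homEquivDual H K := operatorDuality H K

end Hilb

/-! ### Slices of operators -/

section Slices

variable {H K H' K' : Type*}
  [NormedAddCommGroup H] [InnerProductSpace ℂ H]
  [NormedAddCommGroup K] [InnerProductSpace ℂ K]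
  [NormedAddCommGroup H'] [InnerProductSpace ℂ H']
  [NormedAddCommGroup K'] [InnerProductSpace ℂ K']

theorem norm_pureTensorL_le (a : H) : ‖pureTensorL H K a‖ ≤ ‖a‖ :=
  ContinuousLinearMap.opNorm_le_bound _ (norm_nonneg a) fun b => by
    rw [pureTensorL_apply, pureTensor, LinearIsometry.norm_map, TensorProduct.norm_tmul]

theorem norm_pureTensorL_flip_le (b : K) : ‖(pureTensorL H K).flip b‖ ≤ ‖b‖ :=
  ContinuousLinearMap.opNorm_le_bound _ (norm_nonneg b) fun a => by
    rw [ContinuousLinearMap.flip_apply, pureTensorL_apply, pureTensor, LinearIsometry.norm_map,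
      TensorProduct.norm_tmul, mul_comm]

/-- The operator `(⟨a'| ⊗ id) ∘ T ∘ (|a⟩ ⊗ id) : K → K'`, for `T : H ⊗ K → H' ⊗ K'`. -/
noncomputable def firstLegCoeff [CompleteSpace K] [CompleteSpace K']
    (T : HilbertTensor H K →L[ℂ] HilbertTensor H' K') (a : H) (a' : H') : K →L[ℂ] K' :=
  (ContinuousLinearMap.adjoint (pureTensorL H' K' a')).comp (T.comp (pureTensorL H K a))

/-- The operator `(id ⊗ ⟨b'|) ∘ T ∘ (id ⊗ |b⟩) : H → H'`, for `T : H ⊗ K → H' ⊗ K'`. -/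
noncomputable def secondLegCoeff [CompleteSpace H] [CompleteSpace H']
    (T : HilbertTensor H K →L[ℂ] HilbertTensor H' K') (b : K) (b' : K') : H →L[ℂ] H' :=
  (ContinuousLinearMap.adjoint ((pureTensorL H' K').flip b')).comp
    (T.comp ((pureTensorL H K).flip b))

theorem norm_firstLegCoeff_le [CompleteSpace K] [CompleteSpace K']
    (T : HilbertTensor H K →L[ℂ] HilbertTensor H' K') (a : H) (a' : H') :
    ‖firstLegCoeff T a a'‖ ≤ ‖T‖ * ‖a‖ * ‖a'‖ := by
  refine (ContinuousLinearMap.opNorm_comp_le _ _).trans ?_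
  rw [LinearIsometryEquiv.norm_map]
  calc _ ≤ ‖a'‖ * (‖T‖ * ‖a‖) := by
        gcongr
        · exact norm_pureTensorL_le a'
        · exact (ContinuousLinearMap.opNorm_comp_le _ _).trans
            (mul_le_mul_of_nonneg_left (norm_pureTensorL_le a) (norm_nonneg _))
    _ = _ := by ring

theorem norm_secondLegCoeff_le [CompleteSpace H] [CompleteSpace H']
    (T : HilbertTensor H K →L[ℂ] HilbertTensor H' K') (b : K)
    (b' : K') : ‖secondLegCoeff T b b'‖ ≤ ‖T‖ * ‖b‖ * ‖b'‖ := by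
  refine (ContinuousLinearMap.opNorm_comp_le _ _).trans ?_
  rw [LinearIsometryEquiv.norm_map]
  calc _ ≤ ‖b'‖ * (‖T‖ * ‖b‖) := by
        gcongr
        · exact norm_pureTensorL_flip_le b'
        · exact (ContinuousLinearMap.opNorm_comp_le _ _).trans
            (mul_le_mul_of_nonneg_left (norm_pureTensorL_flip_le b) (norm_nonneg _))
    _ = _ := by ring

theorem exists_sliceSecond [CompleteSpace K] [CompleteSpace H'] [CompleteSpace K']
    (ω : OperatorPredual K K')
    (T : HilbertTensor H K →L[ℂ] HilbertTensor H' K') :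
    ∃ S : H →L[ℂ] H', ∀ a a', ⟪a', S a⟫_ℂ = OperatorPredual.toFunctional ω (firstLegCoeff T a a') := by
  refine exists_operator_of_form _ (‖ω‖ * ‖T‖) (by positivity) ?_ ?_ ?_ ?_ ?_
  · intro a b a'
    rw [← map_add]; congr 1
    simp [firstLegCoeff, ContinuousLinearMap.comp_add]
  · intro z a a'
    rw [← smul_eq_mul, ← map_smul]; congr 1
    simp [firstLegCoeff]
  · intro a a' b'
    rw [← map_add]; congr 1
    simp [firstLegCoeff, ContinuousLinearMap.add_comp]
  · intro z a a'
    rw [← smul_eq_mul, ← map_smul]; congr 1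
    simp [firstLegCoeff, ContinuousLinearMap.smul_comp, map_smulₛₗ]
  · intro a a'
    refine (ContinuousLinearMap.le_opNorm _ _).trans ?_
    rw [LinearIsometry.norm_map]
    calc _ ≤ ‖ω‖ * (‖T‖ * ‖a‖ * ‖a'‖) := by gcongr; exact norm_firstLegCoeff_le T a a'
      _ = _ := by ring

theorem exists_sliceFirst [CompleteSpace H] [CompleteSpace H'] [CompleteSpace K']
    (ω : OperatorPredual H H')
    (T : HilbertTensor H K →L[ℂ] HilbertTensor H' K') :
    ∃ S : K →L[ℂ] K', ∀ b b', ⟪b', S b⟫_ℂ = OperatorPredual.toFunctional ω (secondLegCoeff T b b') := by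
  refine exists_operator_of_form _ (‖ω‖ * ‖T‖) (by positivity) ?_ ?_ ?_ ?_ ?_
  · intro a b a'
    rw [← map_add]; congr 1
    simp [secondLegCoeff, ContinuousLinearMap.comp_add]
  · intro z a a'
    rw [← smul_eq_mul, ← map_smul]; congr 1
    simp [secondLegCoeff]
  · intro a a' b'
    rw [← map_add]; congr 1
    simp [secondLegCoeff, ContinuousLinearMap.add_comp]
  · intro z a a'
    rw [← smul_eq_mul, ← map_smul]; congr 1
    simp [secondLegCoeff, ContinuousLinearMap.smul_comp, map_smulₛₗ]
  · intro a a'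
    refine (ContinuousLinearMap.le_opNorm _ _).trans ?_
    rw [LinearIsometry.norm_map]
    calc _ ≤ ‖ω‖ * (‖T‖ * ‖a‖ * ‖a'‖) := by gcongr; exact norm_secondLegCoeff_le T a a'
      _ = _ := by ring

variable [CompleteSpace H] [CompleteSpace K] [CompleteSpace H'] [CompleteSpace K']

/-- The slice `(id ⊗ ω)(T) : H → H'` of `T : H ⊗ K → H' ⊗ K'` by `ω` in `B(K, K')_*`, the unique
operator with `⟪a', (id ⊗ ω)(T) a⟫ = ω((⟨a'| ⊗ id) ∘ T ∘ (|a⟩ ⊗ id))`. -/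
noncomputable def sliceSecond (ω : OperatorPredual K K')
    (T : HilbertTensor H K →L[ℂ] HilbertTensor H' K') : H →L[ℂ] H' :=
  (exists_sliceSecond ω T).choose

theorem inner_sliceSecond (ω : OperatorPredual K K')
    (T : HilbertTensor H K →L[ℂ] HilbertTensor H' K') (a : H) (a' : H') :
    ⟪a', sliceSecond ω T a⟫_ℂ = OperatorPredual.toFunctional ω (firstLegCoeff T a a') :=
  (exists_sliceSecond ω T).choose_spec a a'

/-- The slice `(ω ⊗ id)(T) : K → K'` of `T : H ⊗ K → H' ⊗ K'` by `ω` in `B(H, H')_*`, the unique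
operator with `⟪b', (ω ⊗ id)(T) b⟫ = ω((id ⊗ ⟨b'|) ∘ T ∘ (id ⊗ |b⟩))`. -/
noncomputable def sliceFirst (ω : OperatorPredual H H')
    (T : HilbertTensor H K →L[ℂ] HilbertTensor H' K') : K →L[ℂ] K' :=
  (exists_sliceFirst ω T).choose

theorem inner_sliceFirst (ω : OperatorPredual H H')
    (T : HilbertTensor H K →L[ℂ] HilbertTensor H' K') (b : K) (b' : K') :
    ⟪b', sliceFirst ω T b⟫_ℂ = OperatorPredual.toFunctional ω (secondLegCoeff T b b') :=
  (exists_sliceFirst ω T).choose_spec b b'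

end Slices

/-! ### Regularity of braidings -/

section Regularity

variable {C : Type u} [Category.{v} C] [WStarCategory C] [MonoidalCategory C] [BraidedCategory C]

/-- A braiding is unitary if all `c_{X,Y} : X ⊗ Y ⟶ Y ⊗ X` are unitary. -/
def IsUnitaryBraiding (C : Type u) [Category.{v} C] [WStarCategory C] [MonoidalCategory C]
    [BraidedCategory C] : Prop :=
  ∀ X Y : C, IsUnitaryHom (β_ X Y).hom

/-- The braiding `c_{X,Y}` as a bounded operator `For(X) ⊗ For(Y) → For(Y) ⊗ For(X)`. -/
noncomputable def braidingOp (For : C ⥤ Hilb.{w}) [For.Monoidal] (X Y : C) :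
    HilbertTensor (For.obj X) (For.obj Y) →L[ℂ] HilbertTensor (For.obj Y) (For.obj X) :=
  Functor.LaxMonoidal.μ For X Y ≫ For.map (β_ X Y).hom ≫ Functor.OplaxMonoidal.δ For Y X

/-- The braiding is regular on `(C, ⊗, 𝟙)`: it is unitary, and the slices `(id ⊗ ω)(c_{H,K})`, with
`ω` in `B(For(K), For(H))_*`, span a norm dense subspace of the compact operators from `For(H)` to
`For(K)`. -/
def IsRegularBraiding (For : C ⥤ Hilb.{w}) [For.Monoidal] : Prop :=
  IsUnitaryBraiding C ∧ ∀ H K : C,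
    (closedSpan {S | ∃ ω : OperatorPredual (For.obj K) (For.obj H),
        S = sliceSecond ω (braidingOp For H K)} : Set (For.obj H →L[ℂ] For.obj K)) =
      {T : For.obj H →L[ℂ] For.obj K | IsCompactOperator T}

/-- The braiding is regular on `(C, ⊗ᵒᵖ, 𝟙)`, where `H ⊗ᵒᵖ K = K ⊗ H`, the braiding
`H ⊗ᵒᵖ K ⟶ K ⊗ᵒᵖ H` is `c_{K,H}`, and the second tensor factor for `⊗ᵒᵖ` is the first one for
`⊗`. -/
def IsOpRegularBraiding (For : C ⥤ Hilb.{w}) [For.Monoidal] : Prop :=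
  IsUnitaryBraiding C ∧ ∀ H K : C,
    (closedSpan {S | ∃ ω : OperatorPredual (For.obj K) (For.obj H),
        S = sliceFirst ω (braidingOp For K H)} : Set (For.obj H →L[ℂ] For.obj K)) =
      {T : For.obj H →L[ℂ] For.obj K | IsCompactOperator T}

/-- The braiding is bi-regular: it is regular on `(C, ⊗, 𝟙)` and on `(C, ⊗ᵒᵖ, 𝟙)`. -/
def IsBiregularBraiding (For : C ⥤ Hilb.{w}) [For.Monoidal] : Prop :=
  IsRegularBraiding For ∧ IsOpRegularBraiding For

end Regularity

/-!
Let `H'` be a *strong left dual of `H`, and let `x : H ⊗ H' ⟶ 𝟙`, regarded as a functional on the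
Hilbert space `For(H) ⊗ For(H')`. Naturality of the braiding and the hexagon identity give
`(id_K ⊗ x) ∘ (c_{H,K} ⊗ id) = (x ⊗ id_K) ∘ (id ⊗ c_{H',K}⁻¹)` on `H ⊗ K ⊗ H'`
(`functorBraiding_comp_contract_right`). In terms of slices: for vectors `k` of `For(K)` and `a` of
`For(H')`, the slice of `c_{H,K}` by the vector functional of `k` and of the functional
`e = x(· ⊗ a)` on `For(H)` is `Ψ_x(c_{H',K}⁻¹(k ⊗ a))`, where `Ψ_x(w) h = (x ⊗ id)(h ⊗ w)`. Now
`Ψ_x(a ⊗ k)` is the operator `h ↦ x(h ⊗ a) k` of rank one. Elementary tensors are total, and so are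
their images under the invertible operator `c_{H',K}⁻¹`; hence these slices and the operators
`h ↦ x(h ⊗ a) k` have the same closed span. If the functionals `x(· ⊗ a)` are total, this is the
space of compact operators (`closedSpan_range_eq_compact`).

Totality is where *strong rigidity enters. If `x(h ⊗ a) = 0` for all `x` and `a`, then `h` is killed
by all `(x ⊗ id) ∘ (id ⊗ y)`, which are *strongly dense in `End(H)`. Since vector functionals
composed with a normal *-functor lie in the predual, this forces `h = 0`
(`IsNormalStarFunctor.eq_zero_of_dense`).

For the opposite tensor product the roles of left and right are exchanged, and functionals on
`For(H') ⊗ For(H)` are needed. They come from `x ∘ c_{H',H}`, and they are total because the zigzag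
of `x ∘ c_{H',H}` and `c_{H,H'}⁻¹ ∘ y` on the other side equals that of `x` and `y`
(`braided_zigzag`). The adjoints `y†` would not serve here: neither the associators nor the
structure isomorphisms of `For` are assumed unitary.
-/

/-! ### Dualities and strong monoidal functors -/

section Functor

open Functor.LaxMonoidal Functor.OplaxMonoidal Functor.Monoidal

variable {C : Type u} [Category.{v} C] [MonoidalCategory C]
  {D : Type u'} [Category.{v'} D] [MonoidalCategory D] (F : C ⥤ D) [F.Monoidal]

/-- The image of `x : X ⊗ Y ⟶ 𝟙` under a strong monoidal functor `F`, as a morphism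
`F X ⊗ F Y ⟶ 𝟙`. -/
def functorPairing {X Y : C} (x : X ⊗ Y ⟶ 𝟙_ C) : F.obj X ⊗ F.obj Y ⟶ 𝟙_ D :=
  μ F X Y ≫ F.map x ≫ η F

/-- The image of `y : 𝟙 ⟶ X ⊗ Y` under a strong monoidal functor `F`, as a morphism
`𝟙 ⟶ F X ⊗ F Y`. -/
def functorCopairing {X Y : C} (y : 𝟙_ C ⟶ X ⊗ Y) : 𝟙_ D ⟶ F.obj X ⊗ F.obj Y :=
  ε F ≫ F.map y ≫ δ F X Y

theorem map_zigzag_left {H H' : C} (x : H ⊗ H' ⟶ 𝟙_ C) (y : 𝟙_ C ⟶ H' ⊗ H) :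
    F.map ((ρ_ H).inv ≫ H ◁ y ≫ (α_ H H' H).inv ≫ x ▷ H ≫ (λ_ H).hom) =
      (ρ_ (F.obj H)).inv ≫ F.obj H ◁ functorCopairing F y ≫
        (α_ (F.obj H) (F.obj H') (F.obj H)).inv ≫ functorPairing F x ▷ F.obj H ≫
          (λ_ (F.obj H)).hom := by
  simp only [functorCopairing, functorPairing, Functor.map_comp, map_whiskerLeft,
    map_whiskerRight, map_associator_inv, map_leftUnitor, map_rightUnitor_inv, Category.assoc,
    MonoidalCategory.whiskerLeft_comp, comp_whiskerRight, μ_δ_assoc]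

theorem map_zigzag_right {H H' : C} (x : H' ⊗ H ⟶ 𝟙_ C) (y : 𝟙_ C ⟶ H ⊗ H') :
    F.map ((λ_ H).inv ≫ y ▷ H ≫ (α_ H H' H).hom ≫ H ◁ x ≫ (ρ_ H).hom) =
      (λ_ (F.obj H)).inv ≫ functorCopairing F y ▷ F.obj H ≫
        (α_ (F.obj H) (F.obj H') (F.obj H)).hom ≫ F.obj H ◁ functorPairing F x ≫
          (ρ_ (F.obj H)).hom := by
  simp only [functorCopairing, functorPairing, Functor.map_comp, map_whiskerLeft,
    map_whiskerRight, map_associator, map_leftUnitor_inv, map_rightUnitor, Category.assoc,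
    MonoidalCategory.whiskerLeft_comp, comp_whiskerRight, μ_δ_assoc]

end Functor

/-! ### Dualities in braided categories -/

section Braided

open Functor.LaxMonoidal Functor.OplaxMonoidal Functor.Monoidal

variable {C : Type u} [Category.{v} C] [MonoidalCategory C] [BraidedCategory C]

/-- A morphism `x : X ⊗ Z ⟶ 𝟙` slides past the strand `Y`: this moves the crossing of `Y` with `X`
to the inverse crossing of `Y` with `Z`. -/
theorem braiding_comp_contract_right {X Y Z : C} (x : X ⊗ Z ⟶ 𝟙_ C) :
    (β_ X Y).hom ▷ Z ≫ (α_ Y X Z).hom ≫ Y ◁ x ≫ (ρ_ Y).hom =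
      (α_ X Y Z).hom ≫ X ◁ (β_ Z Y).inv ≫ (α_ X Z Y).inv ≫ x ▷ Y ≫ (λ_ Y).hom := by
  have h : (β_ X Y).hom ▷ Z =
      (α_ X Y Z).hom ≫ X ◁ (β_ Z Y).inv ≫ (α_ X Z Y).inv ≫ (β_ (X ⊗ Z) Y).hom ≫
        (α_ Y X Z).inv := by
    rw [BraidedCategory.hexagon_reverse X Z Y]; simp
  rw [h]
  simp only [Category.assoc, Iso.inv_hom_id_assoc, ← BraidedCategory.braiding_naturality_left_assoc,
    braiding_rightUnitor]

theorem braiding_comp_contract_left {X Y Z : C} (x : X ⊗ Y ⟶ 𝟙_ C) :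
    X ◁ (β_ Z Y).hom ≫ (α_ X Y Z).inv ≫ x ▷ Z ≫ (λ_ Z).hom =
      (α_ X Z Y).inv ≫ (β_ Z X).inv ▷ Y ≫ (α_ Z X Y).hom ≫ Z ◁ x ≫ (ρ_ Z).hom := by
  have h : X ◁ (β_ Z Y).hom =
      (α_ X Z Y).inv ≫ (β_ Z X).inv ▷ Y ≫ (α_ Z X Y).hom ≫ (β_ Z (X ⊗ Y)).hom ≫
        (α_ X Y Z).hom := by
    rw [BraidedCategory.hexagon_forward Z X Y]; simp
  rw [h]
  simp only [Category.assoc, Iso.hom_inv_id_assoc,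
    ← BraidedCategory.braiding_naturality_right_assoc, braiding_leftUnitor]

/-- Composing `x` with the braiding and `y` with the inverse braiding exchanges the two sides on
which `H'` is a dual of `H` without changing the zigzag. In `(id ⊗ (x ∘ c)) ∘ ((c⁻¹ ∘ y) ⊗ id)` the
strand `H` crosses itself twice; naturality of the braiding with respect to `x` and `y` cancels
the crossings. -/
theorem braided_zigzag {H H' : C} (x : H ⊗ H' ⟶ 𝟙_ C) (y : 𝟙_ C ⟶ H' ⊗ H) :
    (λ_ H).inv ≫ (y ≫ (β_ H H').inv) ▷ H ≫ (α_ H H' H).hom ≫ H ◁ ((β_ H' H).hom ≫ x) ≫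
        (ρ_ H).hom =
      (ρ_ H).inv ≫ H ◁ y ≫ (α_ H H' H).inv ≫ x ▷ H ≫ (λ_ H).hom := by
  have h1 : (α_ H H' H).hom ≫ H ◁ (β_ H' H).hom ≫ (α_ H H H').inv ≫ (β_ H H).hom ▷ H' =
      (β_ (H ⊗ H') H).hom ≫ (α_ H H H').inv := by
    rw [← BraidedCategory.hexagon_reverse]; simp
  have h2 : (α_ H H H').hom ≫ H ◁ x ≫ (ρ_ H).hom =
      (β_ H H).hom ▷ H' ≫ (α_ H H H').hom ≫ H ◁ (β_ H H').hom ≫ (α_ H H' H).inv ≫ x ▷ H ≫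
        (λ_ H).hom := by
    rw [← BraidedCategory.hexagon_forward_assoc, Iso.hom_inv_id_assoc,
      ← BraidedCategory.braiding_naturality_right_assoc, braiding_leftUnitor]
  have h3 : (α_ H H' H).hom ≫ H ◁ ((β_ H' H).hom ≫ x) ≫ (ρ_ H).hom =
      (β_ (H ⊗ H') H).hom ≫ H ◁ (β_ H H').hom ≫ (α_ H H' H).inv ≫ x ▷ H ≫ (λ_ H).hom := by
    have := congrArg (fun t => (α_ H H' H).hom ≫ H ◁ (β_ H' H).hom ≫ (α_ H H H').inv ≫ t) h2
    simp only [Iso.inv_hom_id_assoc] at this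
    rw [MonoidalCategory.whiskerLeft_comp, Category.assoc, this, reassoc_of% h1,
      Iso.inv_hom_id_assoc]
  rw [h3, BraidedCategory.braiding_naturality_left_assoc, MonoidalCategory.whiskerLeft_comp]
  simp

variable {D : Type u'} [Category.{v'} D] [MonoidalCategory D] (F : C ⥤ D) [F.Monoidal]

/-- The braiding of `X` and `Y`, seen through a strong monoidal functor `F` as an isomorphism
`F X ⊗ F Y ≅ F Y ⊗ F X`. No braiding of the target category is involved. -/
def functorBraiding (X Y : C) : F.obj X ⊗ F.obj Y ≅ F.obj Y ⊗ F.obj X where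
  hom := μ F X Y ≫ F.map (β_ X Y).hom ≫ δ F Y X
  inv := μ F Y X ≫ F.map (β_ X Y).inv ≫ δ F X Y

theorem functorBraiding_comp_contract_right {X Y Z : C} (x : X ⊗ Z ⟶ 𝟙_ C) :
    (functorBraiding F X Y).hom ▷ F.obj Z ≫ (α_ (F.obj Y) (F.obj X) (F.obj Z)).hom ≫
        F.obj Y ◁ functorPairing F x ≫ (ρ_ (F.obj Y)).hom =
      (α_ (F.obj X) (F.obj Y) (F.obj Z)).hom ≫ F.obj X ◁ (functorBraiding F Z Y).inv ≫
        (α_ (F.obj X) (F.obj Z) (F.obj Y)).inv ≫ functorPairing F x ▷ F.obj Y ≫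
          (λ_ (F.obj Y)).hom := by
  have h := congrArg (fun t => μ F X Y ▷ F.obj Z ≫ μ F _ _ ≫ F.map t)
    (braiding_comp_contract_right (Y := Y) x)
  simpa only [functorBraiding, functorPairing, Functor.map_comp, map_whiskerLeft,
    map_whiskerRight, map_associator, map_associator_inv, map_leftUnitor, map_rightUnitor,
    Category.assoc, MonoidalCategory.whiskerLeft_comp, comp_whiskerRight, μ_δ_assoc,
    whiskerLeft_μ_δ_assoc, whiskerRight_μ_δ_assoc, whiskerLeft_δ_μ_assoc,
    whiskerRight_δ_μ_assoc] using h

theorem functorBraiding_comp_contract_left {X Y Z : C} (x : X ⊗ Y ⟶ 𝟙_ C) :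
    F.obj X ◁ (functorBraiding F Z Y).hom ≫ (α_ (F.obj X) (F.obj Y) (F.obj Z)).inv ≫
        functorPairing F x ▷ F.obj Z ≫ (λ_ (F.obj Z)).hom =
      (α_ (F.obj X) (F.obj Z) (F.obj Y)).inv ≫ (functorBraiding F Z X).inv ▷ F.obj Y ≫
        (α_ (F.obj Z) (F.obj X) (F.obj Y)).hom ≫ F.obj Z ◁ functorPairing F x ≫
          (ρ_ (F.obj Z)).hom := by
  have h := congrArg (fun t => F.obj X ◁ μ F Z Y ≫ μ F _ _ ≫ F.map t)
    (braiding_comp_contract_left (Z := Z) x)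
  simpa only [functorBraiding, functorPairing, Functor.map_comp, map_whiskerLeft,
    map_whiskerRight, map_associator, map_associator_inv, map_leftUnitor, map_rightUnitor,
    Category.assoc, MonoidalCategory.whiskerLeft_comp, comp_whiskerRight, μ_δ_assoc,
    whiskerLeft_μ_δ_assoc, whiskerRight_μ_δ_assoc, whiskerLeft_δ_μ_assoc,
    whiskerRight_δ_μ_assoc] using h

end Braided

/-! ### Compact operators and the predual -/

section CompactOperators

variable {H K : Type*} [NormedAddCommGroup H] [InnerProductSpace ℂ H]
  [NormedAddCommGroup K] [InnerProductSpace ℂ K]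

theorem isCompactOperator_rankOne (k : K) (h : H) :
    IsCompactOperator (InnerProductSpace.rankOne ℂ k h) := by
  rw [InnerProductSpace.rankOne_def']
  have h1 : IsCompactOperator (innerSL ℂ h) := isCompactOperator_of_locallyCompactSpace_dom
    (innerSL ℂ h)
  exact h1.clm_comp (ContinuousLinearMap.toSpanSingleton ℂ k)

/-- The compact operators into a Hilbert space are the norm closed span of the rank one operators:
composing with the projection onto the span of a finite net of the image of the unit ball
approximates a compact operator. -/
theorem IsCompactOperator.mem_of_rankOne_mem [CompleteSpace H] [CompleteSpace K]
    {N : Submodule ℂ (H →L[ℂ] K)}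
    (hN : IsClosed (N : Set (H →L[ℂ] K)))
    (h1 : ∀ k h, InnerProductSpace.rankOne ℂ k h ∈ N) {T : H →L[ℂ] K}
    (hT : IsCompactOperator T) : T ∈ N := by
  rw [← SetLike.mem_coe, ← hN.closure_eq, Metric.mem_closure_iff]
  intro ε hε
  have htb : TotallyBounded (T '' Metric.closedBall 0 1) :=
    (IsCompactOperator.isCompact_closure_image_closedBall (f := T.toLinearMap) hT
      1).totallyBounded.subset subset_closure
  obtain ⟨t, ht, hcov⟩ := Metric.totallyBounded_iff.1 htb (ε / 2) (half_pos hε)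
  let U : Submodule ℂ K := Submodule.span ℂ t
  have : FiniteDimensional ℂ U := FiniteDimensional.span_of_finite ℂ ht
  refine ⟨U.starProjection.comp T, ?_, ?_⟩
  · rw [(stdOrthonormalBasis ℂ U).starProjection_eq_sum_rankOne, SetLike.mem_coe,
      ContinuousLinearMap.finsetSum_comp]
    exact Submodule.sum_mem _ fun i _ => by
      rw [InnerProductSpace.rankOne_comp]; exact h1 _ _
  · refine lt_of_le_of_lt ?_ (half_lt_self hε)
    rw [dist_eq_norm]
    refine ContinuousLinearMap.opNorm_le_of_unit_norm (half_pos hε).le fun x hx => ?_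
    obtain ⟨y, hy, hxy⟩ := Set.mem_iUnion₂.1
      (hcov ⟨x, by simp [hx], rfl⟩)
    have hyU : y ∈ U := Submodule.subset_span hy
    rw [sub_apply, ContinuousLinearMap.comp_apply,
      Submodule.starProjection_minimal]
    refine (ciInf_le ⟨0, ?_⟩ (⟨y, hyU⟩ : U)).trans ?_
    · rintro _ ⟨z, rfl⟩
      exact norm_nonneg _
    · rw [← dist_eq_norm]; exact (Metric.mem_ball.1 hxy).le

end CompactOperators

section Predual

variable {H K : Type*} [NormedAddCommGroup H] [InnerProductSpace ℂ H]
  [NormedAddCommGroup K] [InnerProductSpace ℂ K]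

/-- The bounded conjugate-linear map `η ↦ ⟪η, · ξ⟫` into the predual. -/
noncomputable def OperatorPredual.vectorL (ξ : H) : K →L⋆[ℂ] OperatorPredual H K :=
  LinearMap.mkContinuous
    { toFun := OperatorPredual.vector ξ
      map_add' := fun _ _ => OperatorPredual.ext_apply fun S => by simp
      map_smul' := fun _ _ => OperatorPredual.ext_apply fun S => by simp [mul_comm] }
    ‖ξ‖ fun η => OperatorPredual.norm_vector_le ξ η

theorem OperatorPredual.mem_of_vector_mem {N : Submodule ℂ (OperatorPredual H K)}
    (hN : IsClosed (N : Set (OperatorPredual H K)))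
    (h : ∀ ξ η, OperatorPredual.vector ξ η ∈ N) (ω : OperatorPredual H K) : ω ∈ N := by
  refine ClosedSpan.denseRange_ofSpan.induction_on (p := (· ∈ N)) ω hN ?_
  rintro ⟨x, hx⟩
  induction hx using Submodule.span_induction with
  | mem x hx => obtain ⟨p, rfl⟩ := hx; exact h p.1 p.2
  | zero => exact N.zero_mem
  | add x y hx hy h1 h2 => exact N.add_mem h1 h2
  | smul z x hx h1 => exact N.smul_mem z h1

end Predual

/-! ### A criterion for the slices to span the compact operators -/

section Abstract

variable {H K H' E ι : Type*} [NormedAddCommGroup H] [InnerProductSpace ℂ H] [CompleteSpace H]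
  [NormedAddCommGroup K] [InnerProductSpace ℂ K] [CompleteSpace K]
  [NormedAddCommGroup E] [NormedSpace ℂ E]

theorem Submodule.mem_of_dense_span {σ : ℂ →+* ℂ} {V W : Type*} [NormedAddCommGroup V]
    [NormedSpace ℂ V]
    [NormedAddCommGroup W] [NormedSpace ℂ W] {s : Set V}
    (hs : Dense (Submodule.span ℂ s : Set V)) (A : V →SL[σ] W) {N : Submodule ℂ W}
    (hN : IsClosed (N : Set W)) (h : ∀ v ∈ s, A v ∈ N) (v : V) : A v ∈ N := by
  have h1 : Submodule.span ℂ s ≤ N.comap A.toLinearMap := Submodule.span_le.2 h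
  exact closure_minimal (s := (Submodule.span ℂ s : Set V)) h1 (hN.preimage A.continuous) (hs v)

theorem dense_span_of_forall_inner_eq_zero {s : Set H} (hs : ∀ h, (∀ e ∈ s, ⟪e, h⟫_ℂ = 0) → h = 0) :
    Dense (Submodule.span ℂ s : Set H) := by
  rw [Submodule.dense_iff_topologicalClosure_eq_top, Submodule.topologicalClosure_eq_top_iff,
    Submodule.eq_bot_iff]
  intro h hh
  exact hs h fun e he => (Submodule.mem_orthogonal _ _).1 hh e (Submodule.subset_span he)

/-- Suppose that the values of `S` at the vector functionals `(k, e i a)` can be written as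
`Ψ i (q a k)`, where `Ψ i` takes the value `|k⟩⟨e i a|` at `p a k`. If `p` and `q` are total in `E`
and `e` is total in `H`, then the range of `S` and the operators of rank one have the same closed
span, the space of compact operators. -/
theorem closedSpan_range_eq_compact (S : OperatorPredual K H →L[ℂ] H →L[ℂ] K)
    (e : ι → H' → H) (Ψ : ι → E →L[ℂ] H →L[ℂ] K) (p q : H' → K → E)
    (hp : Dense (Submodule.span ℂ (Set.range fun z : H' × K => p z.1 z.2) : Set E))
    (hq : Dense (Submodule.span ℂ (Set.range fun z : H' × K => q z.1 z.2) : Set E))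
    (he : ∀ h : H, (∀ i a, ⟪e i a, h⟫_ℂ = 0) → h = 0)
    (hS : ∀ i a k, S (OperatorPredual.vector k (e i a)) = Ψ i (q a k))
    (hΨ : ∀ i a k, Ψ i (p a k) = InnerProductSpace.rankOne ℂ k (e i a)) :
    (closedSpan (Set.range S) : Set (H →L[ℂ] K)) =
      {T : H →L[ℂ] K | IsCompactOperator T} := by
  have he' : Dense (Submodule.span ℂ (Set.range fun z : ι × H' => e z.1 z.2) : Set H) :=
    dense_span_of_forall_inner_eq_zero fun h hh => he h fun i a => hh _ ⟨(i, a), rfl⟩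
  apply Set.Subset.antisymm
  · have hc : IsClosed (compactOperator (RingHom.id ℂ) H K : Set (H →L[ℂ] K)) :=
      isClosed_setOfPred_isCompactOperator
    refine closure_minimal (s := (Submodule.span ℂ (Set.range S) : Set (H →L[ℂ] K)))
      (t := compactOperator (RingHom.id ℂ) H K) (Submodule.span_le.2 ?_) hc
    have h1 : ∀ i v, Ψ i v ∈ compactOperator (RingHom.id ℂ) H K := fun i =>
      Submodule.mem_of_dense_span hp (Ψ i) hc <| by
        rintro _ ⟨⟨a, k⟩, rfl⟩
        rw [hΨ]
        exact isCompactOperator_rankOne k (e i a)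
    have h2 : ∀ k h, S (OperatorPredual.vector k h) ∈ compactOperator (RingHom.id ℂ) H K :=
      fun k => Submodule.mem_of_dense_span he' (S.comp (OperatorPredual.vectorL k)) hc <| by
        rintro _ ⟨⟨i, a⟩, rfl⟩
        exact (hS i a k).symm ▸ h1 i _
    rintro _ ⟨ω, rfl⟩
    exact OperatorPredual.mem_of_vector_mem
      (N := (compactOperator (RingHom.id ℂ) H K).comap S.toLinearMap)
      (hc.preimage S.continuous) h2 ω
  · intro T hT
    have hc : IsClosed (closedSpan (Set.range S) : Set (H →L[ℂ] K)) :=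
      Submodule.isClosed_topologicalClosure _
    have h1 : ∀ i v, Ψ i v ∈ closedSpan (Set.range S) := fun i =>
      Submodule.mem_of_dense_span hq (Ψ i) hc <| by
        rintro _ ⟨⟨a, k⟩, rfl⟩
        rw [← hS]
        exact Submodule.le_topologicalClosure _ (Submodule.subset_span ⟨_, rfl⟩)
    refine IsCompactOperator.mem_of_rankOne_mem hc (fun k => ?_) hT
    refine Submodule.mem_of_dense_span he' (InnerProductSpace.rankOne ℂ k) hc ?_
    rintro _ ⟨⟨i, a⟩, rfl⟩
    rw [← hΨ]
    exact h1 i _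

end Abstract

/-! ### Slice maps -/

section Slices

theorem norm_le_of_norm_inner_le {H K : Type*} [NormedAddCommGroup H] [InnerProductSpace ℂ H]
    [NormedAddCommGroup K] [InnerProductSpace ℂ K] {T : H →L[ℂ] K} {c : ℝ} (hc : 0 ≤ c)
    (h : ∀ a b, ‖⟪b, T a⟫_ℂ‖ ≤ c * ‖a‖ * ‖b‖) : ‖T‖ ≤ c := by
  refine T.opNorm_le_bound hc fun a => ?_
  have h1 := h a (T a)
  rw [inner_self_eq_norm_sq_to_K, norm_pow, RCLike.norm_ofReal, abs_norm, sq] at h1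
  rcases (norm_nonneg (T a)).eq_or_lt with h0 | h0
  · rw [← h0]; positivity
  · exact le_of_mul_le_mul_right h1 h0

variable {H K H' K' : Type*}
  [NormedAddCommGroup H] [InnerProductSpace ℂ H] [CompleteSpace H]
  [NormedAddCommGroup K] [InnerProductSpace ℂ K] [CompleteSpace K]
  [NormedAddCommGroup H'] [InnerProductSpace ℂ H'] [CompleteSpace H']
  [NormedAddCommGroup K'] [InnerProductSpace ℂ K'] [CompleteSpace K']

/-- The slice map `ω ↦ (id ⊗ ω)(T)`. -/
noncomputable def sliceSecondL (T : HilbertTensor H K →L[ℂ] HilbertTensor H' K') :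
    OperatorPredual K K' →L[ℂ] H →L[ℂ] H' :=
  LinearMap.mkContinuous
    { toFun := fun ω => sliceSecond ω T
      map_add' := fun ω ω' => ContinuousLinearMap.ext fun a => ext_inner_left ℂ fun b => by
        simp [inner_sliceSecond, inner_add_right]
      map_smul' := fun z ω => ContinuousLinearMap.ext fun a => ext_inner_left ℂ fun b => by
        simp [inner_sliceSecond, inner_smul_right] }
    ‖T‖ fun ω => norm_le_of_norm_inner_le (by positivity) fun a b => by
      refine (congrArg norm (inner_sliceSecond ω T a b)).trans_le ?_
      refine (ContinuousLinearMap.le_opNorm _ _).trans ?_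
      rw [LinearIsometry.norm_map]
      calc _ ≤ ‖ω‖ * (‖T‖ * ‖a‖ * ‖b‖) := by gcongr; exact norm_firstLegCoeff_le T a b
        _ = _ := by ring

/-- The slice map `ω ↦ (ω ⊗ id)(T)`. -/
noncomputable def sliceFirstL (T : HilbertTensor H K →L[ℂ] HilbertTensor H' K') :
    OperatorPredual H H' →L[ℂ] K →L[ℂ] K' :=
  LinearMap.mkContinuous
    { toFun := fun ω => sliceFirst ω T
      map_add' := fun ω ω' => ContinuousLinearMap.ext fun a => ext_inner_left ℂ fun b => by
        simp [inner_sliceFirst, inner_add_right]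
      map_smul' := fun z ω => ContinuousLinearMap.ext fun a => ext_inner_left ℂ fun b => by
        simp [inner_sliceFirst, inner_smul_right] }
    ‖T‖ fun ω => norm_le_of_norm_inner_le (by positivity) fun a b => by
      refine (congrArg norm (inner_sliceFirst ω T a b)).trans_le ?_
      refine (ContinuousLinearMap.le_opNorm _ _).trans ?_
      rw [LinearIsometry.norm_map]
      calc _ ≤ ‖ω‖ * (‖T‖ * ‖a‖ * ‖b‖) := by gcongr; exact norm_secondLegCoeff_le T a b
        _ = _ := by ring

theorem inner_sliceSecondL_vector (T : HilbertTensor H K →L[ℂ] HilbertTensor H' K')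
    (k : K) (k' : K') (a : H) (a' : H') :
    ⟪a', sliceSecondL T (OperatorPredual.vector k k') a⟫_ℂ =
      ⟪pureTensor a' k', T (pureTensor a k)⟫_ℂ := by
  refine (inner_sliceSecond _ T a a').trans ?_
  rw [OperatorPredual.toFunctional_vector, vectorFunctional_apply, firstLegCoeff,
    ContinuousLinearMap.comp_apply, ContinuousLinearMap.adjoint_inner_right]
  rfl

theorem inner_sliceFirstL_vector (T : HilbertTensor H K →L[ℂ] HilbertTensor H' K')
    (a : H) (a' : H') (k : K) (k' : K') :
    ⟪k', sliceFirstL T (OperatorPredual.vector a a') k⟫_ℂ =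
      ⟪pureTensor a' k', T (pureTensor a k)⟫_ℂ := by
  refine (inner_sliceFirst _ T k k').trans ?_
  rw [OperatorPredual.toFunctional_vector, vectorFunctional_apply, secondLegCoeff,
    ContinuousLinearMap.comp_apply, ContinuousLinearMap.adjoint_inner_right]
  rfl

end Slices

/-! ### Functionals on a tensor product of Hilbert spaces -/

section Contractions

variable {H K H' : Type*}
  [NormedAddCommGroup H] [InnerProductSpace ℂ H]
  [NormedAddCommGroup K] [InnerProductSpace ℂ K]
  [NormedAddCommGroup H'] [InnerProductSpace ℂ H']

/-- The operator `id ⊗ f : (K ⊗ H) ⊗ H' → K`, for a functional `f` on `H ⊗ H'`. Functionals take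
values in `HilbertUnit`, the unit object of `Hilb`. -/
noncomputable def pairRight [CompleteSpace K] (f : HilbertTensor H H' →L[ℂ] HilbertUnit.{w}) :
    HilbertTensor (HilbertTensor K H) H' →L[ℂ] K :=
  (unitaryOp (hilbertRid K)).comp ((hilbertTensorMap (ContinuousLinearMap.id ℂ K) f).comp
    (unitaryOp (hilbertAssoc K H H')))

/-- The operator `f ⊗ id : H ⊗ (H' ⊗ K) → K`, for a functional `f` on `H ⊗ H'`. -/
noncomputable def pairLeft [CompleteSpace K] (f : HilbertTensor H H' →L[ℂ] HilbertUnit.{w}) :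
    HilbertTensor H (HilbertTensor H' K) →L[ℂ] K :=
  (unitaryOp (hilbertLid K)).comp ((hilbertTensorMap f (ContinuousLinearMap.id ℂ K)).comp
    (unitaryOp (hilbertAssoc H H' K).symm))

@[simp]
theorem pairRight_pure [CompleteSpace K] (f : HilbertTensor H H' →L[ℂ] HilbertUnit.{w}) (k : K) (h : H)
    (a : H') : pairRight f (pureTensor (pureTensor k h) a) =
      hilbertUnitIso (f (pureTensor h a)) • k := by
  simp [pairRight]

theorem hilbertAssoc_symm_pure (h : H) (a : H') (k : K) :
    (hilbertAssoc H H' K).symm (pureTensor h (pureTensor a k)) =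
      pureTensor (pureTensor h a) k := by
  rw [LinearIsometryEquiv.symm_apply_eq, hilbertAssoc_pure]

@[simp]
theorem pairLeft_pure [CompleteSpace K] (f : HilbertTensor H H' →L[ℂ] HilbertUnit.{w}) (h : H) (a : H')
    (k : K) : pairLeft f (pureTensor h (pureTensor a k)) =
      hilbertUnitIso (f (pureTensor h a)) • k := by
  simp [pairLeft, hilbertAssoc_symm_pure]

/-- The vector `e` of `H` with `⟪e, h⟫ = f (h ⊗ a)`. -/
noncomputable def rieszLeft [CompleteSpace H]
    (f : HilbertTensor H H' →L[ℂ] HilbertUnit.{w}) (a : H') : H :=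
  ContinuousLinearMap.adjoint (f.comp ((pureTensorL H H').flip a)) (hilbertUnitIso.symm 1)

/-- The vector `e` of `H'` with `⟪e, a⟫ = f (h ⊗ a)`. -/
noncomputable def rieszRight [CompleteSpace H']
    (f : HilbertTensor H H' →L[ℂ] HilbertUnit.{w}) (h : H) : H' :=
  ContinuousLinearMap.adjoint (f.comp (pureTensorL H H' h)) (hilbertUnitIso.symm 1)

theorem inner_hilbertUnitIso_symm_one (z : HilbertUnit.{w}) :
    ⟪hilbertUnitIso.symm 1, z⟫_ℂ = hilbertUnitIso z := by
  rw [← hilbertUnitIso.inner_map_map]; simp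

theorem inner_rieszLeft [CompleteSpace H]
    (f : HilbertTensor H H' →L[ℂ] HilbertUnit.{w}) (h : H) (a : H') :
    ⟪rieszLeft f a, h⟫_ℂ = hilbertUnitIso (f (pureTensor h a)) := by
  rw [rieszLeft, ContinuousLinearMap.adjoint_inner_left, inner_hilbertUnitIso_symm_one]; rfl

theorem inner_rieszRight [CompleteSpace H']
    (f : HilbertTensor H H' →L[ℂ] HilbertUnit.{w}) (h : H) (a : H') :
    ⟪rieszRight f h, a⟫_ℂ = hilbertUnitIso (f (pureTensor h a)) := by
  rw [rieszRight, ContinuousLinearMap.adjoint_inner_left, inner_hilbertUnitIso_symm_one]; rfl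

theorem inner_pureTensor_rieszLeft [CompleteSpace H] [CompleteSpace K]
    (f : HilbertTensor H H' →L[ℂ] HilbertUnit.{w}) (k : K)
    (a : H') (v : HilbertTensor K H) :
    ⟪pureTensor k (rieszLeft f a), v⟫_ℂ = ⟪k, pairRight f (pureTensor v a)⟫_ℂ := by
  have : innerSL ℂ (pureTensor k (rieszLeft f a)) = (innerSL ℂ k).comp
      ((pairRight f).comp ((pureTensorL (HilbertTensor K H) H').flip a)) :=
    hilbertTensor_ext fun b c => by
      simp [inner_pureTensor, inner_rieszLeft, mul_comm]
  exact DFunLike.congr_fun this v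

theorem inner_rieszRight_pureTensor [CompleteSpace H'] [CompleteSpace K]
    (f : HilbertTensor H H' →L[ℂ] HilbertUnit.{w}) (k : K)
    (h : H) (v : HilbertTensor H' K) :
    ⟪pureTensor (rieszRight f h) k, v⟫_ℂ = ⟪k, pairLeft f (pureTensor h v)⟫_ℂ := by
  have : innerSL ℂ (pureTensor (rieszRight f h) k) = (innerSL ℂ k).comp
      ((pairLeft f).comp (pureTensorL H (HilbertTensor H' K) h)) :=
    hilbertTensor_ext fun b c => by
      simp [inner_pureTensor, inner_rieszRight]
  exact DFunLike.congr_fun this v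

theorem pairLeft_pureTensor_eq_zero [CompleteSpace H] [CompleteSpace K]
    {f : HilbertTensor H H' →L[ℂ] HilbertUnit.{w}} {h : H}
    (hf : ∀ a, ⟪rieszLeft f a, h⟫_ℂ = 0) (v : HilbertTensor H' K) :
    pairLeft f (pureTensor h v) = 0 := by
  have : (pairLeft f).comp (pureTensorL H (HilbertTensor H' K) h) = 0 :=
    hilbertTensor_ext fun a k => by simp [← inner_rieszLeft, hf]
  exact DFunLike.congr_fun this v

theorem pairRight_pureTensor_eq_zero [CompleteSpace H'] [CompleteSpace K]
    {f : HilbertTensor H H' →L[ℂ] HilbertUnit.{w}} {a : H'}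
    (hf : ∀ h, ⟪rieszRight f h, a⟫_ℂ = 0) (v : HilbertTensor K H) :
    pairRight f (pureTensor v a) = 0 := by
  have : (pairRight f).comp ((pureTensorL (HilbertTensor K H) H').flip a) = 0 :=
    hilbertTensor_ext fun k h => by simp [← inner_rieszRight, hf]
  exact DFunLike.congr_fun this v

theorem dense_span_pureTensor :
    Dense (Submodule.span ℂ (Set.range fun z : H × K => pureTensor z.1 z.2) :
      Set (HilbertTensor H K)) :=
  dense_of_pureTensor_mem fun a b =>
    Submodule.le_topologicalClosure _ (Submodule.subset_span ⟨(a, b), rfl⟩)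

theorem dense_span_pureTensor_swap :
    Dense (Submodule.span ℂ (Set.range fun z : H' × K => pureTensor z.2 z.1) :
      Set (HilbertTensor K H')) :=
  dense_of_pureTensor_mem fun a b =>
    Submodule.le_topologicalClosure _ (Submodule.subset_span ⟨(b, a), rfl⟩)

end Contractions

/-! ### Slices of operators that slide past functionals -/

section SliceCriteria

variable {H K H' : Type*} {ι : Type*}
  [NormedAddCommGroup H] [InnerProductSpace ℂ H] [CompleteSpace H]
  [NormedAddCommGroup K] [InnerProductSpace ℂ K] [CompleteSpace K]
  [NormedAddCommGroup H'] [InnerProductSpace ℂ H']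

theorem dense_span_range_comp {V W κ : Type*} [NormedAddCommGroup V] [NormedSpace ℂ V]
    [NormedAddCommGroup W] [NormedSpace ℂ W] (A : V →L[ℂ] W) (hA : Function.Surjective A)
    {p : κ → V} (hp : Dense (Submodule.span ℂ (Set.range p) : Set V)) :
    Dense (Submodule.span ℂ (Set.range fun z => A (p z)) : Set W) := by
  have h := hA.denseRange.dense_image A.continuous hp
  have h1 : Submodule.span ℂ (Set.range fun z => A (p z)) =
      (Submodule.span ℂ (Set.range p)).map A.toLinearMap := by
    rw [Submodule.map_span, ← Set.range_comp]; rfl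
  rw [h1]
  exact h

/-- If pushing functionals `f i` on `H ⊗ H'` past `T` turns `T` on `H` into `R` on `H'`, and if the
`f i` separate the points of `H`, then the slices of `T` span the compact operators densely. -/
theorem closedSpan_sliceSecond_eq_compact (T : HilbertTensor H K →L[ℂ] HilbertTensor K H)
    (R : HilbertTensor K H' →L[ℂ] HilbertTensor H' K) (hR : Function.Surjective R)
    (f : ι → HilbertTensor H H' →L[ℂ] HilbertUnit.{w})
    (hf : ∀ h : H, (∀ i a, ⟪rieszLeft (f i) a, h⟫_ℂ = 0) → h = 0)
    (hT : ∀ i h k a, pairRight (f i) (pureTensor (T (pureTensor h k)) a) =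
      pairLeft (f i) (pureTensor h (R (pureTensor k a)))) :
    (closedSpan {S | ∃ ω : OperatorPredual K H, S = sliceSecond ω T} : Set (H →L[ℂ] K)) =
      {S : H →L[ℂ] K | IsCompactOperator S} := by
  have hset : {S | ∃ ω : OperatorPredual K H, S = sliceSecond ω T} =
      Set.range (sliceSecondL T) := Set.ext fun S => exists_congr fun ω => eq_comm
  rw [hset]
  refine closedSpan_range_eq_compact (sliceSecondL T) (fun i a => rieszLeft (f i) a)
    (fun i => ((ContinuousLinearMap.compL ℂ _ _ K (pairLeft (f i))).comp
      (pureTensorL H (HilbertTensor H' K))).flip)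
    (fun a k => pureTensor a k) (fun a k => R (pureTensor k a)) dense_span_pureTensor
    (dense_span_range_comp R hR dense_span_pureTensor_swap) hf ?_ ?_
  · refine fun i a k => ContinuousLinearMap.ext fun h => ext_inner_left ℂ fun b => ?_
    rw [inner_sliceSecondL_vector, inner_pureTensor_rieszLeft, hT]
    rfl
  · refine fun i a k => ContinuousLinearMap.ext fun h => ?_
    rw [InnerProductSpace.rankOne_apply, inner_rieszLeft]
    exact pairLeft_pure (f i) h a k

/-- The mirror image of `closedSpan_sliceSecond_eq_compact`, for functionals on `H' ⊗ H`. -/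
theorem closedSpan_sliceFirst_eq_compact (T : HilbertTensor K H →L[ℂ] HilbertTensor H K)
    (R : HilbertTensor H' K →L[ℂ] HilbertTensor K H') (hR : Function.Surjective R)
    (f : ι → HilbertTensor H' H →L[ℂ] HilbertUnit.{w})
    (hf : ∀ h : H, (∀ i a, ⟪rieszRight (f i) a, h⟫_ℂ = 0) → h = 0)
    (hT : ∀ i h k a, pairLeft (f i) (pureTensor a (T (pureTensor k h))) =
      pairRight (f i) (pureTensor (R (pureTensor a k)) h)) :
    (closedSpan {S | ∃ ω : OperatorPredual K H, S = sliceFirst ω T} : Set (H →L[ℂ] K)) =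
      {S : H →L[ℂ] K | IsCompactOperator S} := by
  have hset : {S | ∃ ω : OperatorPredual K H, S = sliceFirst ω T} =
      Set.range (sliceFirstL T) := Set.ext fun S => exists_congr fun ω => eq_comm
  rw [hset]
  refine closedSpan_range_eq_compact (sliceFirstL T) (fun i a => rieszRight (f i) a)
    (fun i => (ContinuousLinearMap.compL ℂ _ _ K (pairRight (f i))).comp
      (pureTensorL (HilbertTensor K H') H))
    (fun a k => pureTensor k a) (fun a k => R (pureTensor a k)) dense_span_pureTensor_swap
    (dense_span_range_comp R hR dense_span_pureTensor) hf ?_ ?_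
  · refine fun i a k => ContinuousLinearMap.ext fun h => ext_inner_left ℂ fun b => ?_
    rw [inner_sliceFirstL_vector, inner_rieszRight_pureTensor, hT]
    rfl
  · refine fun i a k => ContinuousLinearMap.ext fun h => ?_
    rw [InnerProductSpace.rankOne_apply, inner_rieszRight]
    exact pairRight_pure (f i) k a h

end SliceCriteria

/-! ### Vector functionals and the *strong topology -/

section Normal

/-- A morphism of `Hilb` as a bounded operator. -/
def Hilb.toOp {H K : Hilb.{w}} (f : H ⟶ K) : H →L[ℂ] K := f

variable {C : Type u} [Category.{v} C] [WStarCategory C]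

/-- The predual contains every ultraweakly continuous linear functional, because the dual of a weak
topology consists of the functionals that define it. -/
theorem exists_pairing_eq_of_continuous {X Y : C} (φ : (X ⟶ Y) →ₗ[ℂ] ℂ)
    (hφ : @Continuous _ _ (ultraweakTopology X Y) inferInstance φ) :
    ∃ ψ : PreHom X Y, ∀ a, pairing ψ a = φ a := by
  let B : PreHom X Y →ₗ[ℂ] (X ⟶ Y) →ₗ[ℂ] ℂ :=
    LinearMap.mk₂ ℂ pairing (fun ψ ψ' a => map_add (homEquivDual X Y a) ψ ψ')
      (fun z ψ a => map_smul (homEquivDual X Y a) z ψ)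
      (fun ψ a b => by simp [pairing]) (fun z ψ a => by simp [pairing])
  have h := (LinearMap.mem_span_iff_continuous (f := B) φ).2 hφ
  rw [← LinearMap.coe_range, Submodule.span_eq] at h
  obtain ⟨ψ, hψ⟩ := h
  exact ⟨ψ, fun a => DFunLike.congr_fun hψ a⟩

theorem IsNormalStarFunctor.exists_pairing_eq_inner {For : C ⥤ Hilb.{w}}
    (hFor : IsNormalStarFunctor For) {X Y : C} (ξ : For.obj X) (η : For.obj Y) :
    ∃ φ : PreHom X Y, ∀ a, pairing φ a =
      ⟪η, Hilb.toOp (For.map a) ξ⟫_ℂ := by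
  let φ : (X ⟶ Y) →ₗ[ℂ] ℂ :=
    { toFun := fun a => vectorFunctional ξ η (Hilb.toOp (For.map a))
      map_add' := fun a b => by rw [hFor.map_add]; exact _root_.map_add _ _ _
      map_smul' := fun z a => by rw [hFor.map_smul]; exact _root_.map_smul _ _ _ }
  refine exists_pairing_eq_of_continuous φ ?_
  have h : @Continuous _ _ (ultraweakTopology (For.obj X) (For.obj Y)) inferInstance
      (pairing (OperatorPredual.vector ξ η : PreHom (For.obj X) (For.obj Y))) :=
    continuous_iInf_dom continuous_induced_dom
  exact @Continuous.comp _ _ _ (ultraweakTopology X Y)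
    (ultraweakTopology (For.obj X) (For.obj Y)) _ _ _ h (hFor.normal X Y)

/-- A *strongly dense set of endomorphisms has no common null vector: the squared seminorm
`a ↦ ‖For(a) h‖ ^ 2` comes from a positive element of the predual, so that the set contains `a` with
`‖For(a) h - h‖ < ‖h‖` if `h ≠ 0`. -/
theorem IsNormalStarFunctor.eq_zero_of_dense {For : C ⥤ Hilb.{w}}
    (hFor : IsNormalStarFunctor For) {X : C} {D : Set (X ⟶ X)}
    (hD : @Dense _ (starStrongTopology X) D) (h : For.obj X)
    (h0 : ∀ a ∈ D, Hilb.toOp (For.map a) h = 0) : h = 0 := by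
  obtain ⟨φ, hφ⟩ := hFor.exists_pairing_eq_inner h h
  have hsq : ∀ a : X ⟶ X, pairing φ (a ≫ dagger a) =
      ((‖Hilb.toOp (For.map a) h‖ ^ 2 : ℝ) : ℂ) := by
    intro a
    rw [hφ, For.map_comp, hFor.map_dagger]
    refine (ContinuousLinearMap.adjoint_inner_right
      (Hilb.toOp (For.map a)) h _).trans ?_
    exact (inner_self_eq_norm_sq_to_K (Hilb.toOp (For.map a) h)).trans (by norm_cast)
  have hpos : IsPositiveNormal φ := fun a => by
    rw [hsq]
    exact Complex.zero_le_real.2 (sq_nonneg _)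
  by_contra hne
  -- The semi-ball of radius `‖h‖` around the identity.
  let U : Set (X ⟶ X) := {a | √(pairing φ ((a - 𝟙 X) ≫ dagger (a - 𝟙 X))).re < ‖h‖}
  have hU : @IsOpen _ (starStrongTopology X) U :=
    TopologicalSpace.isOpen_generateFrom_of_mem ⟨φ, hpos, 𝟙 X, ‖h‖, Or.inl rfl⟩
  have hmap : ∀ a, Hilb.toOp (For.map (a - 𝟙 X)) h =
      Hilb.toOp (For.map a) h - h := by
    intro a
    have h1 : For.map a = For.map (a - 𝟙 X) + 𝟙 (For.obj X) := by
      rw [← For.map_id, ← hFor.map_add, sub_add_cancel]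
    rw [h1, eq_sub_iff_add_eq]
    rfl
  have hval : ∀ a, √(pairing φ ((a - 𝟙 X) ≫ dagger (a - 𝟙 X))).re =
      ‖Hilb.toOp (For.map a) h - h‖ := by
    intro a
    rw [hsq, Complex.ofReal_re, Real.sqrt_sq (norm_nonneg _), hmap]
  have h1U : 𝟙 X ∈ U := by
    change √_ < ‖h‖
    have h1 : Hilb.toOp (𝟙 (For.obj X)) h = h := rfl
    rw [hval, For.map_id, h1, sub_self, norm_zero]
    exact norm_pos_iff.2 hne
  obtain ⟨a, haU, haD⟩ :=
    (@dense_iff_inter_open _ (starStrongTopology X) _).1 hD U hU ⟨_, h1U⟩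
  change √_ < ‖h‖ at haU
  rw [hval, h0 a haD, zero_sub, norm_neg] at haU
  exact lt_irrefl _ haU

end Normal

/-! ### Regularity of a braiding -/

section Concrete

variable {C : Type u} [Category.{v} C] [MonoidalCategory C]
  {For : C ⥤ Hilb.{w}} [For.Monoidal]

theorem Hilb.leftUnitor_inv_apply (H : Hilb.{w}) (h : H) :
    Hilb.toOp (λ_ H).inv h =
      pureTensor (hilbertUnitIso.symm 1) h :=
  (LinearIsometryEquiv.symm_apply_eq (hilbertLid H)).2 (by simp)

theorem Hilb.rightUnitor_inv_apply (H : Hilb.{w}) (h : H) :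
    Hilb.toOp (ρ_ H).inv h =
      pureTensor h (hilbertUnitIso.symm 1) :=
  (LinearIsometryEquiv.symm_apply_eq (hilbertRid H)).2 (by simp)

theorem map_zigzag_left_apply {H H' : C} (x : H ⊗ H' ⟶ 𝟙_ C) (y : 𝟙_ C ⟶ H' ⊗ H)
    (h : For.obj H) :
    Hilb.toOp (For.map ((ρ_ H).inv ≫ H ◁ y ≫ (α_ H H' H).inv ≫ x ▷ H ≫ (λ_ H).hom)) h =
      pairLeft (H := For.obj H) (H' := For.obj H') (K := For.obj H) (functorPairing For x)
        (pureTensor h (Hilb.toOp (functorCopairing For y) (hilbertUnitIso.symm 1))) := by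
  rw [map_zigzag_left]
  refine (congrArg (pairLeft (H := For.obj H) (H' := For.obj H') (K := For.obj H)
    (functorPairing For x)) ?_)
  refine (congrArg (hilbertTensorMap (ContinuousLinearMap.id ℂ (For.obj H))
      (Hilb.toOp (functorCopairing For y)))
    (Hilb.rightUnitor_inv_apply _ h)).trans ?_
  exact hilbertTensorMap_pure _ _ _ _

theorem map_zigzag_right_apply {H H' : C} (x : H' ⊗ H ⟶ 𝟙_ C) (y : 𝟙_ C ⟶ H ⊗ H')
    (h : For.obj H) :
    Hilb.toOp (For.map ((λ_ H).inv ≫ y ▷ H ≫ (α_ H H' H).hom ≫ H ◁ x ≫ (ρ_ H).hom)) h =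
      pairRight (H := For.obj H') (H' := For.obj H) (K := For.obj H) (functorPairing For x)
        (pureTensor (Hilb.toOp (functorCopairing For y) (hilbertUnitIso.symm 1)) h) := by
  rw [map_zigzag_right]
  refine (congrArg (pairRight (H := For.obj H') (H' := For.obj H) (K := For.obj H)
    (functorPairing For x)) ?_)
  refine (congrArg (hilbertTensorMap (Hilb.toOp (functorCopairing For y))
      (ContinuousLinearMap.id ℂ (For.obj H)))
    (Hilb.leftUnitor_inv_apply _ h)).trans ?_
  exact hilbertTensorMap_pure _ _ _ _

theorem Hilb.surjective_of_iso {H K : Hilb.{w}} (e : H ≅ K) :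
    Function.Surjective (Hilb.toOp e.hom) := fun k =>
  ⟨Hilb.toOp e.inv k, DFunLike.congr_fun (F := K →L[ℂ] K) e.inv_hom_id k⟩

variable [WStarCategory C] [BraidedCategory C]

/-- A vector killed by all functionals on `For(H) ⊗ For(H')` coming from `H ⊗ H' ⟶ 𝟙` is killed by
all operators `(x ⊗ id) ∘ (id ⊗ y)`, so *strong duality makes these functionals separate points. -/
theorem IsStarStrongLeftDual.isRegular (hFor : IsNormalStarFunctor For) {H H' : C}
    (hH : IsStarStrongLeftDual H H') (K : C) :
    (closedSpan {S | ∃ ω : OperatorPredual (For.obj K) (For.obj H),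
        S = sliceSecond ω (braidingOp For H K)} : Set (For.obj H →L[ℂ] For.obj K)) =
      {T : For.obj H →L[ℂ] For.obj K | IsCompactOperator T} := by
  refine closedSpan_sliceSecond_eq_compact (H' := For.obj H') (ι := H ⊗ H' ⟶ 𝟙_ C)
    (braidingOp For H K) (functorBraiding For H' K).inv
    (Hilb.surjective_of_iso (functorBraiding For H' K).symm)
    (fun x => functorPairing For x) ?_ ?_
  · intro h hh
    refine hFor.eq_zero_of_dense hH.1 h ?_
    rintro _ ⟨x, y, rfl⟩
    rw [map_zigzag_left_apply]
    exact pairLeft_pureTensor_eq_zero (hh x) _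
  · intro x h k a
    have := DFunLike.congr_fun
      (F := HilbertTensor (HilbertTensor (For.obj H) (For.obj K)) (For.obj H') →L[ℂ] For.obj K)
      (functorBraiding_comp_contract_right For (Y := K) x) (pureTensor (pureTensor h k) a)
    let f : HilbertTensor (For.obj H) (For.obj H') →L[ℂ] HilbertUnit.{w} := functorPairing For x
    refine ((congrArg (pairRight f) (hilbertTensorMap_pure _ _ _ _).symm).trans this).trans
      (congrArg (pairLeft f) ?_)
    exact (congrArg (hilbertTensorMap (ContinuousLinearMap.id ℂ (For.obj H))
      (Hilb.toOp (functorBraiding For H' K).inv)) (hilbertAssoc_pure h k a)).trans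
        (hilbertTensorMap_pure _ _ _ _)

/-- Here the functionals come from the morphisms `x ∘ c_{H',H} : H' ⊗ H ⟶ 𝟙`. By `braided_zigzag`
they separate points for the same reason as the morphisms `x` do. -/
theorem IsStarStrongLeftDual.isOpRegular (hFor : IsNormalStarFunctor For) {H H' : C}
    (hH : IsStarStrongLeftDual H H') (K : C) :
    (closedSpan {S | ∃ ω : OperatorPredual (For.obj K) (For.obj H),
        S = sliceFirst ω (braidingOp For K H)} : Set (For.obj H →L[ℂ] For.obj K)) =
      {T : For.obj H →L[ℂ] For.obj K | IsCompactOperator T} := by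
  refine closedSpan_sliceFirst_eq_compact (H' := For.obj H') (ι := H ⊗ H' ⟶ 𝟙_ C)
    (braidingOp For K H) (functorBraiding For K H').inv
    (Hilb.surjective_of_iso (functorBraiding For K H').symm)
    (fun x => functorPairing For ((β_ H' H).hom ≫ x)) ?_ ?_
  · intro h hh
    refine hFor.eq_zero_of_dense hH.1 h ?_
    rintro _ ⟨x, y, rfl⟩
    rw [← braided_zigzag, map_zigzag_right_apply]
    exact pairRight_pureTensor_eq_zero (hh x) _
  · intro x h k a
    have := DFunLike.congr_fun
      (F := HilbertTensor (For.obj H') (HilbertTensor (For.obj K) (For.obj H)) →L[ℂ] For.obj K)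
      (functorBraiding_comp_contract_left For (Z := K) ((β_ H' H).hom ≫ x))
        (pureTensor a (pureTensor k h))
    let f : HilbertTensor (For.obj H') (For.obj H) →L[ℂ] HilbertUnit.{w} :=
      functorPairing For ((β_ H' H).hom ≫ x)
    refine ((congrArg (pairLeft f) (hilbertTensorMap_pure _ _ _ _).symm).trans this).trans
      (congrArg (pairRight f) ?_)
    exact (congrArg (hilbertTensorMap (Hilb.toOp (functorBraiding For K H').inv)
      (ContinuousLinearMap.id ℂ (For.obj H))) (hilbertAssoc_symm_pure a k h)).trans
        (hilbertTensorMap_pure _ _ _ _)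

end Concrete

theorem mainTheorem8 {C : Type u} [Category.{v} C] [WStarCategory C] [MonoidalCategory C]
    [MonoidalWStarCategory C]
    (For : C ⥤ Hilb.{w}) [For.Monoidal] (hFor : IsNormalStarFunctor For)
    (hrigid : IsStarStronglyRigid C)
    [BraidedCategory C] (hc : IsUnitaryBraiding C) :
    IsBiregularBraiding For := by
  refine ⟨⟨hc, fun H K => ?_⟩, ⟨hc, fun H K => ?_⟩⟩
  · obtain ⟨H', hH⟩ := hrigid H
    exact hH.isRegular hFor K
  · obtain ⟨H', hH⟩ := hrigid H
    exact hH.isOpRegular hFor K
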